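/- Let $M\ge 2$ and consider $M$ bosonic modes with annihilation operators $a_1,\dots,a_M$ on $L^2(\mathbb R^M)$, $a_m=(x_m+\partial_{x_m})/\sqrt2$. For $\vec\alpha\in\mathbb C^M$ let $D(\vec\alpha)=\exp\big(\sum_m(\alpha_m a_m^\dagger-\alpha_m^* a_m)\big)$ be the displacement operator, write $\vec 1=(1,\dots,1)$, and let $\Pi_{-M}=\exp\big(i\pi(\sum_m a_m^\dagger a_m-a_+^\dagger a_+)\big)$ with $a_+=M^{-1/2}\sum_m a_m$ be the parity of the relative modes; equivalently, $\Pi_{-M}$ acts by $f\mapsto f\circ R$, where $R$ is the orthogonal reflection of $\mathbb R^M$ that fixes $\vec 1$ and is $-1$ on $\vec 1^\perp$. A state $\rho$ (a positive trace-class operator with trace one) is called genuinely multipartite entangled (GME) if it is not a finite or countable mixture $\sum_k p_k\,\rho_{\mathcal A_k}\otimes\rho_{\bar{\mathcal A}_k}$, with $p_k\ge0$, $\sum_k p_k=1$, where each $(\mathcal A_k\,|\,\bar{\mathcal A}_k)$ is a bipartition of the modes into two nonempty sets and $\rho_{\mathcal A_k}$, $\rho_{\bar{\mathcal A}_k}$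 are states of the modes in $\mathcal A_k$ and in $\bar{\mathcal A}_k$. Let $\rho$ be a state of the $M$ modes, let $\xi_1,\dots,\xi_N\in\mathbb C$, and let $\mathbf C\in\mathbb C^{N\times N}$ be the matrix $$[\mathbf C]_{n,n'}=\frac1N\operatorname{tr}\big[\rho\,\Pi_{-M}\,D\big((\xi_n-\xi_{n'})\vec 1\big)\big].$$ Then: 1. The entries of $\mathbf C$ are obtained with a controlled relative-mode parity followed by local displacements: with $c\Pi_{-M}=|{\uparrow}\rangle\langle{\uparrow}|\otimes\mathbb 1+|{\downarrow}\rangle\langle{\downarrow}|\otimes\Pi_{-M}$, $|+\rangle=(|{\uparrow}\rangle+|{\downarrow}\rangle)/\sqrt2$ and $\sigma_x=|{\uparrow}\rangle\langle{\downarrow}|+|{\downarrow}\rangle\langle{\uparrow}|$, for all $n,n'$, $$[\mathbf C]_{n,n'}=\frac1N\operatorname{tr}\Big[\big(\sigma_x\otimes D((\xi_n-\xi_{n'})\vec 1)\big)\;c\Pi_{-M}\,\big(|+\rangle\langle+|\otimes\rho\big)\,c\Pi_{-M}^\dagger\Big],$$ where all operators under the traces are trace class. 2. $\mathbf C=\mathbf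 C^\dagger$. 3. If the trace norm (the sum of the singular values) of $\mathbf C$ satisfies $\|\mathbf C\|_1>\dfrac{M}{2\sqrt{M-1}}$, then $\rho$ is GME. -/

import Mathlib

open MeasureTheory
open scoped InnerProductSpace ComplexConjugate

noncomputable section

namespace CVWitness

/-! ### Trace and density operators -/

/-- The operator `T` is trace class with trace `c`: in every orthonormal basis the sum of the
diagonal matrix elements converges unconditionally to `c`. -/
def HasTrace {H : Type} [NormedAddCommGroup H] [InnerProductSpace ℂ H]
    (T : H →L[ℂ] H) (c : ℂ) : Prop :=
  ∀ (ι : Type) (b : HilbertBasis ι ℂ H), HasSum (fun i => ⟪b i, T (b i)⟫_ℂ) c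

open Classical in
/-- The trace of an operator (the value `0` is used for operators that are not trace class). -/
def trace {H : Type} [NormedAddCommGroup H] [InnerProductSpace ℂ H] (T : H →L[ℂ] H) : ℂ :=
  if h : ∃ c, HasTrace T c then h.choose else 0

/-- Quantum states: positive trace-class operators of trace one. -/
def IsDensity {H : Type} [NormedAddCommGroup H] [InnerProductSpace ℂ H] [CompleteSpace H]
    (ρ : H →L[ℂ] H) : Prop :=
  ρ.IsPositive ∧ HasTrace ρ 1

/-! ### The Hilbert space of a finite family of modes -/

/-- The state space `L²(ℝ^ι)` of the modes labelled by `ι`, in the position (Schrödinger)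
representation, in which `a_m = (x_m + ∂/∂x_m)/√2`. -/
abbrev ModeSpace (ι : Type) [Fintype ι] : Type :=
  Lp ℂ 2 (volume : Measure (ι → ℝ))

theorem memLp_weightedComp {ι : Type} [Fintype ι] {S : (ι → ℝ) → (ι → ℝ)}
    (hS : MeasurePreserving S) {u : (ι → ℝ) → ℂ} (hu : Measurable u) (hu1 : ∀ x, ‖u x‖ = 1)
    (f : ModeSpace ι) : MemLp (fun x => u x * f (S x)) 2 volume :=
  ((Lp.memLp f).comp_measurePreserving hS).of_le_mul (c := 1)
    (hu.aestronglyMeasurable.mul ((Lp.memLp f).comp_measurePreserving hS).aestronglyMeasurable)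
    (.of_forall fun x => by simp [hu1])

/-- For a measure preserving map `S` and a measurable function `u` of modulus one,
the isometry `f ↦ u · (f ∘ S)`. -/
def weightedComp {ι : Type} [Fintype ι] (S : (ι → ℝ) → (ι → ℝ))
    (hS : MeasurePreserving S) (u : (ι → ℝ) → ℂ) (hu : Measurable u) (hu1 : ∀ x, ‖u x‖ = 1) :
    ModeSpace ι →L[ℂ] ModeSpace ι :=
  LinearMap.mkContinuous
    { toFun := fun f => (memLp_weightedComp hS hu hu1 f).toLp _
      map_add' := fun f g => by
        rw [← MemLp.toLp_add, MemLp.toLp_eq_toLp_iff]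
        filter_upwards [hS.quasiMeasurePreserving.ae (Lp.coeFn_add f g)] with x hx
        simp only [Pi.add_apply] at hx ⊢
        rw [hx, mul_add]
      map_smul' := fun c f => by
        rw [RingHom.id_apply, ← MemLp.toLp_const_smul, MemLp.toLp_eq_toLp_iff]
        filter_upwards [hS.quasiMeasurePreserving.ae (Lp.coeFn_smul c f)] with x hx
        simp only [Pi.smul_apply, smul_eq_mul] at hx ⊢
        rw [hx]; ring }
    1 (fun f => by
      rw [one_mul, LinearMap.coe_mk, AddHom.coe_mk, Lp.norm_toLp, Lp.norm_def]
      refine ENNReal.toReal_mono (Lp.eLpNorm_ne_top f) ?_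
      rw [← eLpNorm_comp_measurePreserving (Lp.aestronglyMeasurable f) hS]
      exact (eLpNorm_congr_norm_ae (.of_forall fun x => by simp [hu1])).le)

theorem coeFn_weightedComp {ι : Type} [Fintype ι] (S : (ι → ℝ) → (ι → ℝ))
    (hS : MeasurePreserving S) (u : (ι → ℝ) → ℂ) (hu : Measurable u) (hu1 : ∀ x, ‖u x‖ = 1)
    (f : ModeSpace ι) :
    weightedComp S hS u hu hu1 f =ᵐ[volume] fun x => u x * f (S x) :=
  (memLp_weightedComp hS hu hu1 f).coeFn_toLp

/-- The displacement operator `D(α) = exp(∑ₘ (αₘ aₘ† - αₘ* aₘ)) = ⨂ₘ Dₘ(αₘ)`. With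
`qₘ = √2 Re αₘ` and `pₘ = √2 Im αₘ` the exponent is `∑ₘ (i pₘ xₘ - qₘ ∂/∂xₘ)`, so that
`(D(α) f)(x) = ∏ₘ exp(i (pₘ xₘ - qₘ pₘ / 2)) · f(x - q)`. -/
def displacement {ι : Type} [Fintype ι] (α : ι → ℂ) : ModeSpace ι →L[ℂ] ModeSpace ι :=
  weightedComp (fun x => x - fun m => √2 * (α m).re) (measurePreserving_sub_right volume _)
    (fun x => ∏ m, Complex.exp
      (((√2 * (α m).im * x m - (√2 * (α m).re) * (√2 * (α m).im) / 2 : ℝ) : ℂ) * Complex.I))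
    (by fun_prop)
    (fun x => by
      rw [norm_prod]
      exact Finset.prod_eq_one fun m _ => Complex.norm_exp_ofReal_mul_I _)

/-- The reflection of `ℝ^M` that fixes the centre-of-mass direction `(1, …, 1)` and is `-1` on its
orthogonal complement: `x_m ↦ -x_m + (2/M) ∑_{m'} x_{m'}`. -/
def relReflection (M : ℕ) : (Fin M → ℝ) →ₗ[ℝ] (Fin M → ℝ) where
  toFun x := fun m => -x m + 2 / M * ∑ m', x m'
  map_add' x y := by
    ext m; simp only [Pi.add_apply, Finset.sum_add_distrib]; ring
  map_smul' c x := by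
    ext m
    simp only [Pi.smul_apply, smul_eq_mul, RingHom.id_apply, ← Finset.mul_sum]; ring

theorem relReflection_relReflection (M : ℕ) : relReflection M ∘ₗ relReflection M = LinearMap.id := by
  ext1 i
  ext m
  have hM : (M : ℝ) ≠ 0 := by
    have := m.pos
    positivity
  simp [relReflection, Finset.sum_add_distrib]
  field_simp
  ring

theorem measurePreserving_relReflection (M : ℕ) : MeasurePreserving (relReflection M) := by
  have h : LinearMap.det (relReflection M) * LinearMap.det (relReflection M) = 1 := by
    rw [← LinearMap.det_comp, relReflection_relReflection, LinearMap.det_id]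
  have h0 : LinearMap.det (relReflection M) ≠ 0 := fun h' => by simp [h'] at h
  refine ⟨(LinearMap.continuous_of_finiteDimensional _).measurable, ?_⟩
  rw [Real.map_linearMap_volume_pi_eq_smul_volume_pi h0]
  have h1 : |(LinearMap.det (relReflection M))⁻¹| = 1 := by
    rcases mul_self_eq_one_iff.mp h with h2 | h2 <;> simp [h2]
  rw [h1]; simp

/-- The relative-mode parity `Π_{-M} = exp(iπ (∑ₘ aₘ† aₘ - a₊† a₊))`, where
`a₊ = M^{-1/2} ∑ₘ aₘ`: the parity operator of the `M - 1` modes orthogonal to `a₊`. It is the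
multiport beamsplitter with `Π_{-M} aₘ Π_{-M} = -aₘ + (2/M) ∑_{m'} a_{m'}`, acting in the position
representation as `f ↦ f ∘ R`, with `R` the reflection `relReflection M`. -/
def relParity (M : ℕ) : ModeSpace (Fin M) →L[ℂ] ModeSpace (Fin M) :=
  weightedComp (relReflection M) (measurePreserving_relReflection M) (fun _ => 1)
    measurable_const (fun _ => norm_one)

/-! ### Genuine multipartite entanglement -/

theorem memLp_tensor {M : ℕ} (A : Finset (Fin M))
    (f : ModeSpace {m // m ∈ A}) (g : ModeSpace {m // m ∉ A}) :
    MemLp (fun x : Fin M → ℝ => f (fun m => x m) * g (fun m => x m)) 2 volume := by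
  have key : MemLp (fun z : ({m // m ∈ A} → ℝ) × ({m // m ∉ A} → ℝ) => f z.1 * g z.2) 2
      (volume.prod volume) := by
    rw [memLp_two_iff_integrable_sq_norm]
    · have hf := (memLp_two_iff_integrable_sq_norm (Lp.memLp f).1).1 (Lp.memLp f)
      have hg := (memLp_two_iff_integrable_sq_norm (Lp.memLp g).1).1 (Lp.memLp g)
      simpa only [norm_mul, mul_pow] using hf.mul_prod hg
    · exact ((Lp.memLp f).1.comp_fst).mul ((Lp.memLp g).1.comp_snd)
  have e := volume_preserving_piEquivPiSubtypeProd (fun _ : Fin M => ℝ) (fun m => m ∈ A)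
  have e' : MeasurePreserving
      (fun x : Fin M → ℝ => ((fun m => x m, fun m => x m) :
        ({m // m ∈ A} → ℝ) × ({m // m ∉ A} → ℝ))) volume (volume.prod volume) := by
    convert e
    any_goals rfl
    rw [Measure.volume_eq_prod]
    congr!
  exact key.comp_measurePreserving e'

/-- The product vector `f ⊗ g`, for `f` a vector of the modes in `A` and `g` a vector of the
remaining modes. -/
def tensor {M : ℕ} (A : Finset (Fin M))
    (f : ModeSpace {m // m ∈ A}) (g : ModeSpace {m // m ∉ A}) : ModeSpace (Fin M) :=
  (memLp_tensor A f g).toLp _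

/-- `T = ρ_A ⊗ ρ_Ā` for some states `ρ_A`, `ρ_Ā` of the modes in `A` and of the remaining modes
(an operator is determined by its values on product vectors, which are total). -/
def IsProductState {M : ℕ} (A : Finset (Fin M))
    (T : ModeSpace (Fin M) →L[ℂ] ModeSpace (Fin M)) : Prop :=
  ∃ (ρA : ModeSpace {m // m ∈ A} →L[ℂ] ModeSpace {m // m ∈ A})
    (ρB : ModeSpace {m // m ∉ A} →L[ℂ] ModeSpace {m // m ∉ A}),
    IsDensity ρA ∧ IsDensity ρB ∧ ∀ f g, T (tensor A f g) = tensor A (ρA f) (ρB g)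

/-- `ρ` is a (finite or countably infinite) statistical mixture of states, each of which is a
product with respect to some bipartition `(A | Ā)` of the modes into two nonempty parts. -/
def IsBiseparableMixture {M : ℕ} (ρ : ModeSpace (Fin M) →L[ℂ] ModeSpace (Fin M)) : Prop :=
  ∃ (p : ℕ → ℝ) (A : ℕ → Finset (Fin M))
    (T : ℕ → (ModeSpace (Fin M) →L[ℂ] ModeSpace (Fin M))),
    (∀ k, 0 ≤ p k) ∧ HasSum p 1 ∧
    (∀ k, (A k).Nonempty ∧ (A k)ᶜ.Nonempty ∧ IsProductState (A k) (T k)) ∧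
    HasSum (fun k => (p k : ℂ) • T k) ρ

/-- A state is genuinely multipartite entangled if it is not a mixture of biseparable states. -/
def IsGME {M : ℕ} (ρ : ModeSpace (Fin M) →L[ℂ] ModeSpace (Fin M)) : Prop :=
  ¬ IsBiseparableMixture ρ

/-! ### The measurement circuit -/

/-- The joint space `ℂ² ⊗ H` of a qubit and a system `H`; the components `0` and `1` belong to the
qubit states `|↑⟩` and `|↓⟩`. -/
abbrev WithQubit (H : Type) [NormedAddCommGroup H] : Type := PiLp 2 (fun _ : Fin 2 => H)

/-- The operator `A ⊗ T` on `ℂ² ⊗ H`. -/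
def qubitTensor {H : Type} [NormedAddCommGroup H] [InnerProductSpace ℂ H]
    (A : Matrix (Fin 2) (Fin 2) ℂ) (T : H →L[ℂ] H) : WithQubit H →L[ℂ] WithQubit H :=
  (PiLp.continuousLinearEquiv 2 ℂ (fun _ : Fin 2 => H)).symm.toContinuousLinearMap ∘L
    ContinuousLinearMap.pi fun i => ∑ j, A i j • (T ∘L PiLp.proj 2 (fun _ : Fin 2 => H) j)

/-- The controlled operation `cU = |↑⟩⟨↑| ⊗ 1 + |↓⟩⟨↓| ⊗ U`. -/
def controlled {H : Type} [NormedAddCommGroup H] [InnerProductSpace ℂ H]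
    (U : H →L[ℂ] H) : WithQubit H →L[ℂ] WithQubit H :=
  qubitTensor !![1, 0; 0, 0] (ContinuousLinearMap.id ℂ H) + qubitTensor !![0, 0; 0, 1] U

/-- The operator `(σₓ ⊗ D(ξ·1)) cΠ_{-M} (|+⟩⟨+| ⊗ ρ) cΠ_{-M}†`: the qubit is prepared in `|+⟩`,
the controlled relative-mode parity is applied, then `σₓ` is measured on the qubit together with the
local displacements `D(ξ)` on every mode. -/
def circuitOperator {M : ℕ} (ρ : ModeSpace (Fin M) →L[ℂ] ModeSpace (Fin M)) (ξ : ℂ) :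
    WithQubit (ModeSpace (Fin M)) →L[ℂ] WithQubit (ModeSpace (Fin M)) :=
  qubitTensor !![0, 1; 1, 0] (displacement fun _ : Fin M => ξ) ∘L controlled (relParity M) ∘L
    qubitTensor !![1/2, 1/2; 1/2, 1/2] ρ ∘L (controlled (relParity M)).adjoint

/-- The matrix `C` with entries `(1/N) tr[ρ Π_{-M} D((ξ_n - ξ_{n'})·1)]`. -/
def witnessMatrix {M N : ℕ} (ρ : ModeSpace (Fin M) →L[ℂ] ModeSpace (Fin M)) (ξ : Fin N → ℂ) :
    Matrix (Fin N) (Fin N) ℂ :=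
  Matrix.of fun n n' =>
    1 / (N : ℂ) * trace (ρ ∘L relParity M ∘L displacement fun _ : Fin M => ξ n - ξ n')

/-- The trace norm of a square matrix: the sum of its singular values. -/
def matrixTraceNorm {N : ℕ} (C : Matrix (Fin N) (Fin N) ℂ) : ℝ :=
  ∑ k : Fin N, (Matrix.toEuclideanLin C).singularValues k

end CVWitness

end

/-! A density operator is a norm convergent sum ∑ₛ |vₛ⟩⟨vₛ| with ∑ₛ ‖vₛ‖² = 1, and then tr(A ρ B) =
∑ₛ ⟨vₛ, B A vₛ⟩ (`IsEnsemble.hasTrace`). As the relative parity Π commutes with D = D(ξ·1), the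
circuit produces (DΠ + ΠD)/2 = ΠD, and the adjoint of ΠD is ΠD(-ξ·1). This gives the circuit formula
and Hermiticity.

For the criterion, a biseparable ρ is an ensemble of product vectors, and ‖C‖₁ = ∑ U n n' C n n' for
some contraction U. So it suffices to bound ∑ U n n' ⟨v, ΠD v⟩ for v = φ ⊗ χ, with m modes in one
block and l in the other, m + l = M. At fixed total position, ΠD evaluates v at the reflection of x
in a diagonal point y·1, which acts on the two blocks separately. With q = √2 Re ξ and p = √2 Im ξ,
the matrix element becomes M ∫ exp(i p M y) g_A(y, s) g_B(y, Mq/2 - s) dy ds, where g_A, g_B are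
correlations along fibres of constant block total (`fibreCorr`). Since q and p are differences of a
term in n and a term in n', a translation of s gives M ∫ aₙ bₙ', each factor depending on one index
only. Contractivity of U under the integral and Cauchy–Schwarz bound the sum by N M ‖g_A‖ ‖g_B‖.

Finally ‖g_A‖² ≤ ‖φ‖⁴ / (2m): Cauchy–Schwarz on a fibre bounds |g_A(y, s)|² by the product of the
masses of φ at totals my + s and my - s, a change of variables of Jacobian 2m. The result N M /
(2√(ml)) is largest for ml = M - 1, and the factor 1/N in C removes N. -/

noncomputable section

namespace CVWitness

/-! ### Traces of ensembles -/

section Ensemble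

variable {H K : Type} [NormedAddCommGroup H] [InnerProductSpace ℂ H]
  [NormedAddCommGroup K] [InnerProductSpace ℂ K] {σ : Type}

/-- The operator `T` is the norm convergent sum `∑ₛ |vₛ⟩⟨vₛ|`, with `∑ₛ ‖vₛ‖² = w`. -/
structure IsEnsemble (v : σ → H) (w : ℝ) (T : H →L[ℂ] H) : Prop where
  hasSum_weight : HasSum (fun s => ‖v s‖ ^ 2) w
  hasSum : HasSum (fun s => InnerProductSpace.rankOne ℂ (v s) (v s)) T

theorem IsEnsemble.hasSum_inner {v : σ → H} {w : ℝ} {T : H →L[ℂ] H} (h : IsEnsemble v w T)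
    (f g : H) : HasSum (fun s => ⟪f, v s⟫_ℂ * ⟪v s, g⟫_ℂ) ⟪f, T g⟫_ℂ := by
  have h1 := (innerSL ℂ f).hasSum ((ContinuousLinearMap.apply ℂ H g).hasSum h.hasSum)
  simpa [inner_smul_right, mul_comm] using h1

theorem hasSum_sq_norm_inner {ι : Type} (b : HilbertBasis ι ℂ H) (x : H) :
    HasSum (fun i => ‖⟪b i, x⟫_ℂ‖ ^ 2) (‖x‖ ^ 2) := by
  have h := Complex.hasSum_re (b.hasSum_inner_mul_inner x x)
  rw [inner_self_eq_norm_sq_to_K] at h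
  convert h using 1
  · ext i
    rw [← inner_conj_symm x (b i), Complex.conj_mul']
    norm_cast
  · norm_cast

variable [CompleteSpace H]

theorem summable_rankOne {v : σ → H} (hv : Summable fun s => ‖v s‖ ^ 2) :
    Summable fun s => InnerProductSpace.rankOne ℂ (v s) (v s) :=
  .of_norm <| by simpa [← pow_two] using hv

/-- A norm summable family of vectors is an ensemble of every operator with the same matrix
elements. -/
theorem IsEnsemble.of_inner {v : σ → H} {w : ℝ} {T : H →L[ℂ] H}
    (hw : HasSum (fun s => ‖v s‖ ^ 2) w)
    (h : ∀ f g, HasSum (fun s => ⟪f, v s⟫_ℂ * ⟪v s, g⟫_ℂ) ⟪f, T g⟫_ℂ) : IsEnsemble v w T := by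
  refine ⟨hw, ?_⟩
  -- The sum converges in norm because |v⟩⟨v| has norm ‖v‖²; matrix elements only identify the
  -- limit.
  obtain ⟨T', hT'⟩ := summable_rankOne hw.summable
  suffices T' = T from this ▸ hT'
  ext1 g
  refine ext_inner_left ℂ fun f => HasSum.unique ?_ (h f g)
  have h1 := (innerSL ℂ f).hasSum ((ContinuousLinearMap.apply ℂ H g).hasSum hT')
  simpa [inner_smul_right, mul_comm] using h1

/-- The vectors are √ρ bᵢ for a Hilbert basis b: their squared norms ⟨bᵢ, ρ bᵢ⟩ add up to the trace,
and Parseval expands ⟨√ρ f, √ρ g⟩. -/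
theorem exists_isEnsemble {ρ : H →L[ℂ] H} (hρ : IsDensity ρ) :
    ∃ (σ : Type) (v : σ → H), IsEnsemble v 1 ρ := by
  obtain ⟨w, b, -⟩ := exists_hilbertBasis ℂ H
  have h0 : 0 ≤ ρ := (ContinuousLinearMap.nonneg_iff_isPositive ρ).2 hρ.1
  set S : H →L[ℂ] H := CFC.sqrt ρ
  have hS : ∀ x y, ⟪S x, y⟫_ℂ = ⟪x, S y⟫_ℂ :=
    ((ContinuousLinearMap.nonneg_iff_isPositive S).1 (CFC.sqrt_nonneg ρ)).isSymmetric
  have hSS : ∀ x, S (S x) = ρ x := fun x => by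
    rw [← mul_apply_eq_comp, CFC.sqrt_mul_sqrt_self ρ h0]
  refine ⟨w, fun i => S (b i), .of_inner ?_ fun f g => ?_⟩
  · have h := Complex.hasSum_re (hρ.2 w b)
    convert h using 1
    · ext i
      rw [← hSS, ← hS, inner_self_eq_norm_sq_to_K]
      norm_cast
    · simp
  · simpa only [hS, hSS] using b.hasSum_inner_mul_inner (S f) (S g)

-- Absolute convergence, from |xy| ≤ x² + y² and Parseval in the basis index, which leaves a series
-- dominated by (‖A‖² + ‖B†‖²) ‖vₛ‖². It licenses exchanging the two sums in the trace formula.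
variable [CompleteSpace K] in
theorem IsEnsemble.summable_inner_mul_inner {v : σ → H} {w : ℝ} {T : H →L[ℂ] H}
    (h : IsEnsemble v w T) {ι : Type} (b : HilbertBasis ι ℂ K) (A : H →L[ℂ] K) (B : K →L[ℂ] H) :
    Summable fun p : σ × ι => ⟪b p.2, A (v p.1)⟫_ℂ * ⟪v p.1, B (b p.2)⟫_ℂ := by
  have hF : Summable fun p : σ × ι =>
      ‖⟪b p.2, A (v p.1)⟫_ℂ‖ ^ 2 + ‖⟪b p.2, B.adjoint (v p.1)⟫_ℂ‖ ^ 2 := by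
    have hFs : ∀ s, HasSum (fun i => ‖⟪b i, A (v s)⟫_ℂ‖ ^ 2 + ‖⟪b i, B.adjoint (v s)⟫_ℂ‖ ^ 2)
        (‖A (v s)‖ ^ 2 + ‖B.adjoint (v s)‖ ^ 2) := fun s =>
      (hasSum_sq_norm_inner b _).add (hasSum_sq_norm_inner b _)
    refine (summable_prod_of_nonneg fun p => by positivity).2 ⟨fun s => (hFs s).summable, ?_⟩
    simp only [(hFs _).tsum_eq]
    have hw := h.hasSum_weight.summable.mul_left (‖A‖ ^ 2 + ‖B.adjoint‖ ^ 2)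
    refine hw.of_nonneg_of_le (fun s => by positivity) fun s => ?_
    rw [add_mul, ← mul_pow, ← mul_pow]
    gcongr <;> exact ContinuousLinearMap.le_opNorm _ _
  refine .of_norm (hF.of_nonneg_of_le (fun p => norm_nonneg _) fun p => ?_)
  rw [norm_mul, ← B.adjoint_inner_left, ← norm_inner_symm (b p.2)]
  generalize ‖⟪b p.2, A (v p.1)⟫_ℂ‖ = x
  generalize ‖⟪b p.2, B.adjoint (v p.1)⟫_ℂ‖ = y
  nlinarith [sq_nonneg (x - y), sq_nonneg x, sq_nonneg y]

variable [CompleteSpace K] in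
/-- If `T = ∑ₛ |vₛ⟩⟨vₛ|`, then `A T B` is trace class, with trace `∑ₛ ⟨vₛ, B A vₛ⟩`. -/
theorem IsEnsemble.hasTrace {v : σ → H} {w : ℝ} {T : H →L[ℂ] H} (h : IsEnsemble v w T)
    (A : H →L[ℂ] K) (B : K →L[ℂ] H) :
    HasTrace (A ∘L T ∘L B) (∑' s, ⟪v s, B (A (v s))⟫_ℂ) := by
  intro ι b
  have hB : ∀ s k, ⟪v s, B k⟫_ℂ = ⟪B.adjoint (v s), k⟫_ℂ := fun s k =>
    (B.adjoint_inner_left k (v s)).symm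
  have hA : ∀ s k, ⟪k, A (v s)⟫_ℂ = ⟪A.adjoint k, v s⟫_ℂ := fun s k =>
    (A.adjoint_inner_left (v s) k).symm
  have hs : ∀ s, HasSum (fun i => ⟪b i, A (v s)⟫_ℂ * ⟪v s, B (b i)⟫_ℂ) ⟪v s, B (A (v s))⟫_ℂ := by
    intro s
    simp only [hB]
    simpa only [mul_comm] using b.hasSum_inner_mul_inner (B.adjoint (v s)) (A (v s))
  -- Summing the double family over the basis first gives ⟨vₛ, B A vₛ⟩; summing over s first gives
  -- the diagonal elements of A T B.
  have hsum := h.summable_inner_mul_inner b A B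
  have h1 : HasSum (fun s => ⟪v s, B (A (v s))⟫_ℂ) (∑' p : σ × ι, _) :=
    hsum.hasSum.prod_fiberwise hs
  rw [h1.tsum_eq]
  refine ((Equiv.prodComm σ ι).symm.hasSum_iff.2 hsum.hasSum).prod_fiberwise fun i => ?_
  have := h.hasSum_inner (A.adjoint (b i)) (B (b i))
  change HasSum (fun s => ⟪b i, A (v s)⟫_ℂ * ⟪v s, B (b i)⟫_ℂ) _
  simpa only [← hA, ContinuousLinearMap.comp_apply, ContinuousLinearMap.adjoint_inner_left]
    using this

theorem HasTrace.trace_eq {T : H →L[ℂ] H} {c : ℂ} (h : HasTrace T c) : trace T = c := by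
  obtain ⟨w, b, -⟩ := exists_hilbertBasis ℂ H
  have h' : ∃ c, HasTrace T c := ⟨c, h⟩
  rw [trace, dif_pos h']
  exact (h'.choose_spec w b).unique (h w b)

end Ensemble

/-! ### Duality for the trace norm of a matrix -/

/-- The bilinear form with matrix `U` has norm at most one for the Euclidean norms. -/
def IsBilinContraction {N : ℕ} (U : Matrix (Fin N) (Fin N) ℂ) : Prop :=
  ∀ a b : Fin N → ℂ, ‖∑ n, ∑ n', U n n' * (a n * b n')‖ ≤
    √(∑ n, ‖a n‖ ^ 2) * √(∑ n, ‖b n‖ ^ 2)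

/-- Cauchy–Schwarz in k reduces the claim to the two Bessel inequalities. -/
theorem isBilinContraction_sum {N : ℕ} {κ : Type} [Fintype κ] (f e : κ → EuclideanSpace ℂ (Fin N))
    (hf : ∀ a, ∑ k, ‖⟪f k, a⟫_ℂ‖ ^ 2 ≤ ‖a‖ ^ 2) (he : ∀ a, ∑ k, ‖⟪a, e k⟫_ℂ‖ ^ 2 ≤ ‖a‖ ^ 2) :
    IsBilinContraction (Matrix.of fun n n' => ∑ k, conj (f k n) * e k n') := by
  intro a b
  let a' : EuclideanSpace ℂ (Fin N) := WithLp.toLp 2 a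
  -- The form is bilinear while the inner product is conjugate linear on the left, so `b` enters
  -- conjugated.
  let b' : EuclideanSpace ℂ (Fin N) := WithLp.toLp 2 fun n => conj (b n)
  have h : ∑ n, ∑ n', Matrix.of (fun n n' => ∑ k, conj (f k n) * e k n') n n' * (a n * b n')
      = ∑ k, ⟪f k, a'⟫_ℂ * ⟪b', e k⟫_ℂ := by
    simp only [Matrix.of_apply, Finset.sum_mul, PiLp.inner_apply, RCLike.inner_apply, a', b',
      Finset.mul_sum, Complex.conj_conj]
    calc _ = ∑ n, ∑ k, ∑ n', conj (f k n) * e k n' * (a n * b n') :=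
          Finset.sum_congr rfl fun n _ => Finset.sum_comm
      _ = ∑ k, ∑ n, ∑ n', conj (f k n) * e k n' * (a n * b n') := Finset.sum_comm
      _ = ∑ k, ∑ n', ∑ n, conj (f k n) * e k n' * (a n * b n') :=
          Finset.sum_congr rfl fun n _ => Finset.sum_comm
      _ = _ := by
        refine Finset.sum_congr rfl fun k _ => Finset.sum_congr rfl fun n' _ =>
          Finset.sum_congr rfl fun n _ => ?_
        ring
  have ha : √(∑ n, ‖a n‖ ^ 2) = ‖a'‖ := by rw [EuclideanSpace.norm_eq]
  have hb : √(∑ n, ‖b n‖ ^ 2) = ‖b'‖ := by simp [EuclideanSpace.norm_eq, b']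
  rw [h, ha, hb]
  calc _ ≤ ∑ k, ‖⟪f k, a'⟫_ℂ‖ * ‖⟪b', e k⟫_ℂ‖ := by
        simpa only [norm_mul] using
          norm_sum_le Finset.univ fun k => ⟪f k, a'⟫_ℂ * ⟪b', e k⟫_ℂ
    _ ≤ √(∑ k, ‖⟪f k, a'⟫_ℂ‖ ^ 2) * √(∑ k, ‖⟪b', e k⟫_ℂ‖ ^ 2) :=
        Real.sum_mul_le_sqrt_mul_sqrt _ _ _
    _ ≤ ‖a'‖ * ‖b'‖ := by
        gcongr
        · exact Real.sqrt_le_iff.2 ⟨norm_nonneg _, hf a'⟩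
        · exact Real.sqrt_le_iff.2 ⟨norm_nonneg _, he b'⟩

/-- Singular value decomposition: with e an eigenbasis of T†T and fₖ = T eₖ / sₖ, the form pairs C
to ∑ₖ ⟨fₖ, T eₖ⟩ = ∑ₖ sₖ. -/
theorem exists_isBilinContraction_sum_eq {N : ℕ} (C : Matrix (Fin N) (Fin N) ℂ) :
    ∃ U : Matrix (Fin N) (Fin N) ℂ, IsBilinContraction U ∧
      ∑ n, ∑ n', U n n' * C n n' = (matrixTraceNorm C : ℂ) := by
  set T := Matrix.toEuclideanLin C
  have hN : Module.finrank ℂ (EuclideanSpace ℂ (Fin N)) = N := by simp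
  have hsym := T.isSymmetric_adjoint_comp_self
  set e := hsym.eigenvectorBasis hN
  set s : Fin N → ℝ := fun k => T.singularValues k
  have horth : ∀ j k, ⟪T (e j), T (e k)⟫_ℂ = if j = k then ((s k : ℂ)) ^ 2 else 0 := by
    intro j k
    rw [← LinearMap.adjoint_inner_right, ← LinearMap.comp_apply, hsym.apply_eigenvectorBasis,
      ← T.sq_singularValues_fin hN, inner_smul_right, orthonormal_iff_ite.1 e.orthonormal]
    split_ifs <;> simp [s]
  -- For sₖ = 0 the convention 0⁻¹ = 0 makes fₖ = 0. The remaining fₖ are orthonormal, so Bessel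
  -- still holds.
  set f : Fin N → EuclideanSpace ℂ (Fin N) := fun k => ((s k : ℂ))⁻¹ • T (e k)
  have hf0 : ∀ k, s k = 0 → f k = 0 := fun k hk => by simp [f, hk]
  have hfo : Orthonormal ℂ (fun k : {k // s k ≠ 0} => f k) := by
    rw [orthonormal_iff_ite]
    rintro ⟨j, hj⟩ ⟨k, hk⟩
    simp only [f, inner_smul_left, inner_smul_right, horth, Subtype.mk.injEq]
    split_ifs with h
    · subst h
      have : (s j : ℂ) ≠ 0 := by exact_mod_cast hj
      simp only [map_inv₀, Complex.conj_ofReal]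
      field_simp
    · simp
  refine ⟨_, isBilinContraction_sum f e (fun a => ?_) (fun a => ?_), ?_⟩
  · have h := hfo.sum_inner_products_le a (s := Finset.univ)
    refine le_trans (le_of_eq ?_) h
    rw [← Finset.sum_subtype (Finset.univ.filter fun k => s k ≠ 0) (by simp)
      (fun k => ‖⟪f k, a⟫_ℂ‖ ^ 2)]
    refine (Finset.sum_filter_of_ne fun k _ hk => ?_).symm
    contrapose! hk
    simp [hf0 k hk]
  · exact (e.sum_sq_norm_inner_left a).le
  · have hk : ∀ k, ⟪f k, T (e k)⟫_ℂ = s k := by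
      intro k
      simp only [f, inner_smul_left, horth, if_true, map_inv₀, Complex.conj_ofReal]
      by_cases h : s k = 0
      · simp [h]
      · have : (s k : ℂ) ≠ 0 := by exact_mod_cast h
        field_simp
    rw [matrixTraceNorm, Complex.ofReal_sum]
    change _ = ∑ k, ((s k : ℝ) : ℂ)
    simp only [← hk]
    simp only [Matrix.of_apply, Finset.sum_mul, PiLp.inner_apply, RCLike.inner_apply, T,
      Matrix.toLpLin_apply, Matrix.mulVec, dotProduct]
    calc _ = ∑ n, ∑ k, ∑ n', conj (f k n) * e k n' * C n n' :=
          Finset.sum_congr rfl fun n _ => Finset.sum_comm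
      _ = ∑ k, ∑ n, ∑ n', conj (f k n) * e k n' * C n n' := Finset.sum_comm
      _ = _ := by
        refine Finset.sum_congr rfl fun k _ => Finset.sum_congr rfl fun n _ =>
          Finset.sum_congr rfl fun n' _ => ?_
        ring

/-! ### Displacements and the relative parity -/

section WeightedComp

variable {ι : Type} [Fintype ι]

theorem norm_weightedComp (S : (ι → ℝ) → (ι → ℝ)) (hS : MeasurePreserving S)
    (u : (ι → ℝ) → ℂ) (hu : Measurable u) (hu1 : ∀ x, ‖u x‖ = 1) (f : ModeSpace ι) :
    ‖weightedComp S hS u hu hu1 f‖ = ‖f‖ := by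
  rw [Lp.norm_def, Lp.norm_def, ← eLpNorm_comp_measurePreserving (Lp.aestronglyMeasurable f) hS]
  congr 1
  refine eLpNorm_congr_norm_ae ?_
  filter_upwards [coeFn_weightedComp S hS u hu hu1 f] with x hx
  rw [hx, norm_mul, hu1, one_mul, Function.comp_apply]

theorem weightedComp_weightedComp_ae {S T : (ι → ℝ) → (ι → ℝ)} (hS : MeasurePreserving S)
    (hT : MeasurePreserving T) {u v : (ι → ℝ) → ℂ} (hu : Measurable u) (hu1 : ∀ x, ‖u x‖ = 1)
    (hv : Measurable v) (hv1 : ∀ x, ‖v x‖ = 1) (f : ModeSpace ι) :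
    weightedComp S hS u hu hu1 (weightedComp T hT v hv hv1 f)
      =ᵐ[volume] fun x => u x * (v (S x) * f (T (S x))) := by
  filter_upwards [coeFn_weightedComp S hS u hu hu1 (weightedComp T hT v hv hv1 f),
    hS.quasiMeasurePreserving.ae (coeFn_weightedComp T hT v hv hv1 f)] with x hx hx'
  rw [hx, hx']

/-- A weighted composition operator with an inverse weighted composition operator is unitary. -/
theorem adjoint_weightedComp {S T : (ι → ℝ) → (ι → ℝ)} (hS : MeasurePreserving S)
    (hT : MeasurePreserving T) {u v : (ι → ℝ) → ℂ} (hu : Measurable u) (hu1 : ∀ x, ‖u x‖ = 1)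
    (hv : Measurable v) (hv1 : ∀ x, ‖v x‖ = 1) (hST : ∀ x, T (S x) = x)
    (huv : ∀ x, u x * v (S x) = 1) :
    (weightedComp S hS u hu hu1).adjoint = weightedComp T hT v hv hv1 := by
  set U := weightedComp S hS u hu hu1
  set V := weightedComp T hT v hv hv1
  have hUV : ∀ f, U (V f) = f := fun f => by
    refine Lp.ext ((weightedComp_weightedComp_ae hS hT hu hu1 hv hv1 f).trans (.of_forall ?_))
    intro x
    simp only [hST, ← mul_assoc, huv, one_mul]
  have hU : U.adjoint ∘L U = ContinuousLinearMap.id ℂ _ :=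
    (ContinuousLinearMap.norm_map_iff_adjoint_comp_self U).1
      fun f => norm_weightedComp S hS u hu hu1 f
  ext1 f
  -- U is an isometry with right inverse V, hence U† = U†UV = V.
  calc U.adjoint f = (U.adjoint ∘L U) (V f) := by simp [hUV]
    _ = V f := by rw [hU]; rfl

end WeightedComp

theorem displacement_phase {ι : Type} [Fintype ι] (α : ι → ℂ) (x : ι → ℝ) :
    (∏ m, Complex.exp
      (((√2 * (α m).im * x m - (√2 * (α m).re) * (√2 * (α m).im) / 2 : ℝ) : ℂ) * Complex.I))
    = Complex.exp (((∑ m, (√2 * (α m).im * x m - (α m).re * (α m).im) : ℝ) : ℂ) * Complex.I) := by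
  rw [← Complex.exp_sum, ← Finset.sum_mul, Complex.ofReal_sum]
  congr 2
  refine Finset.sum_congr rfl fun m _ => ?_
  congr 1
  have h := Real.mul_self_sqrt (zero_le_two (α := ℝ))
  linear_combination (-(α m).re * (α m).im / 2) * h

theorem coeFn_displacement {ι : Type} [Fintype ι] (α : ι → ℂ) (f : ModeSpace ι) :
    displacement α f =ᵐ[volume] fun x =>
      Complex.exp (((∑ m, (√2 * (α m).im * x m - (α m).re * (α m).im) : ℝ) : ℂ) * Complex.I) *
        f (x - fun m => √2 * (α m).re) := by
  refine (coeFn_weightedComp _ _ _ _ _ f).trans (.of_forall fun x => ?_)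
  simp only [displacement_phase]

theorem adjoint_displacement {ι : Type} [Fintype ι] (α : ι → ℂ) :
    (displacement α).adjoint = displacement (-α) := by
  refine adjoint_weightedComp _ _ _ _ _ _ (fun x => ?_) (fun x => ?_)
  · ext m; simp
  · rw [displacement_phase, displacement_phase, ← Complex.exp_add, ← add_mul, ← Complex.ofReal_add,
      ← Finset.sum_add_distrib, Finset.sum_eq_zero]
    · simp
    · intro m _
      have h := Real.mul_self_sqrt (zero_le_two (α := ℝ))
      simp only [Pi.neg_apply, Complex.neg_re, Complex.neg_im, Pi.sub_apply]
      linear_combination (α m).re * (α m).im * h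

theorem relReflection_apply {M : ℕ} (x : Fin M → ℝ) (m : Fin M) :
    relReflection M x m = -x m + 2 / M * ∑ m', x m' := rfl

theorem sum_relReflection {M : ℕ} (x : Fin M → ℝ) : ∑ m, relReflection M x m = ∑ m, x m := by
  rcases Nat.eq_zero_or_pos M with rfl | hM
  · simp
  · have : (M : ℝ) ≠ 0 := by positivity
    simp only [relReflection_apply, Finset.sum_add_distrib, Finset.sum_neg_distrib,
      Finset.sum_const, Finset.card_univ, Fintype.card_fin, nsmul_eq_mul]
    field_simp
    ring

theorem adjoint_relParity (M : ℕ) : (relParity M).adjoint = relParity M :=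
  adjoint_weightedComp _ _ _ _ _ _
    (fun x => LinearMap.congr_fun (relReflection_relReflection M) x) (fun _ => one_mul _)

theorem relParity_displacement_ae {M : ℕ} (ξ : ℂ) (f : ModeSpace (Fin M)) :
    relParity M (displacement (fun _ => ξ) f) =ᵐ[volume] fun x =>
      Complex.exp (((√2 * ξ.im * ∑ m, x m - M * (ξ.re * ξ.im) : ℝ) : ℂ) * Complex.I) *
        f (relReflection M x - fun _ => √2 * ξ.re) := by
  refine (weightedComp_weightedComp_ae _ _ _ _ _ _ f).trans (.of_forall fun x => ?_)
  simp only [displacement_phase, one_mul]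
  rw [Finset.sum_sub_distrib, ← Finset.mul_sum, sum_relReflection]
  simp

/-- The reflection is linear, fixes the diagonal direction of the translation, and preserves the
total position on which the phase depends. -/
theorem relParity_displacement {M : ℕ} (ξ : ℂ) :
    relParity M ∘L displacement (fun _ => ξ) = displacement (fun _ => ξ) ∘L relParity M := by
  ext1 f
  have hS := measurePreserving_sub_right (volume : Measure (Fin M → ℝ)) fun _ => √2 * ξ.re
  refine Lp.ext ?_
  filter_upwards [relParity_displacement_ae ξ f, coeFn_displacement (fun _ => ξ) (relParity M f),
    hS.quasiMeasurePreserving.ae (coeFn_weightedComp (relReflection M)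
      (measurePreserving_relReflection M) (fun _ => 1) measurable_const (fun _ => norm_one) f)]
    with x h1 h2 h3
  simp only [ContinuousLinearMap.comp_apply]
  rw [h1, h2, relParity, h3, one_mul, Finset.sum_sub_distrib, ← Finset.mul_sum]
  congr 2
  · simp
  · ext m
    have : (M : ℝ) ≠ 0 := by
      have := m.pos
      positivity
    simp only [relReflection_apply, Pi.sub_apply, Finset.sum_sub_distrib, Finset.sum_const,
      Finset.card_univ, Fintype.card_fin, nsmul_eq_mul]
    field_simp
    ring

/-! ### The measurement circuit and the symmetry of the witness matrix -/

section Circuit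

variable {H : Type} [NormedAddCommGroup H] [InnerProductSpace ℂ H]

theorem qubitTensor_apply (A : Matrix (Fin 2) (Fin 2) ℂ) (T : H →L[ℂ] H) (f : WithQubit H)
    (i : Fin 2) : qubitTensor A T f i = ∑ j, A i j • T (f j) := by
  simp [qubitTensor]

theorem controlled_apply_zero (U : H →L[ℂ] H) (f : WithQubit H) : controlled U f 0 = f 0 := by
  simp [controlled, qubitTensor_apply]

theorem controlled_apply_one (U : H →L[ℂ] H) (f : WithQubit H) : controlled U f 1 = U (f 1) := by
  simp [controlled, qubitTensor_apply]

/-- The map `f ↦ |↑⟩ ⊗ f + |↓⟩ ⊗ f`. -/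
def diagonal (H : Type) [NormedAddCommGroup H] [InnerProductSpace ℂ H] : H →L[ℂ] WithQubit H :=
  (PiLp.continuousLinearEquiv 2 ℂ (fun _ : Fin 2 => H)).symm.toContinuousLinearMap ∘L
    ContinuousLinearMap.pi fun _ => ContinuousLinearMap.id ℂ H

/-- The map `|↑⟩ ⊗ f + |↓⟩ ⊗ g ↦ (f + g) / 2`. -/
def average (H : Type) [NormedAddCommGroup H] [InnerProductSpace ℂ H] : WithQubit H →L[ℂ] H :=
  (1 / 2 : ℂ) • ∑ j, PiLp.proj 2 (fun _ : Fin 2 => H) j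

/-- This factorisation puts the circuit operator in the form A ρ B required by
`IsEnsemble.hasTrace`. -/
theorem qubitTensor_plus (T : H →L[ℂ] H) :
    qubitTensor !![1/2, 1/2; 1/2, 1/2] T = diagonal H ∘L T ∘L average H := by
  ext f i
  fin_cases i <;> simp [qubitTensor_apply, diagonal, average]

theorem adjoint_controlled [CompleteSpace H] (U : H →L[ℂ] H) :
    (controlled U).adjoint = controlled U.adjoint := by
  refine ((ContinuousLinearMap.eq_adjoint_iff _ _).2 fun f g => ?_).symm
  simp [PiLp.inner_apply, Fin.sum_univ_two, controlled_apply_zero, controlled_apply_one,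
    ContinuousLinearMap.adjoint_inner_left]

end Circuit

/-- This is the product B A for the circuit. The branch |↑⟩ yields DΠ and |↓⟩ yields ΠD; they
coincide, so averaging changes nothing. -/
theorem average_circuit {M : ℕ} (ξ : ℂ) :
    average _ ∘L (controlled (relParity M)).adjoint ∘L
      qubitTensor !![0, 1; 1, 0] (displacement fun _ : Fin M => ξ) ∘L
        controlled (relParity M) ∘L diagonal _ = relParity M ∘L displacement fun _ => ξ := by
  ext1 f
  have h := DFunLike.congr_fun (relParity_displacement (M := M) ξ) f
  simp only [ContinuousLinearMap.comp_apply] at h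
  rw [adjoint_controlled, adjoint_relParity]
  simp only [average, ContinuousLinearMap.comp_apply, Fin.sum_univ_two, smul_apply,
    add_apply, PiLp.proj_apply, controlled_apply_zero, controlled_apply_one, qubitTensor_apply]
  simp [diagonal, ← h, ← two_smul ℂ, smul_smul]

theorem exists_hasTrace {M : ℕ} {ρ : ModeSpace (Fin M) →L[ℂ] ModeSpace (Fin M)} {σ : Type}
    {v : σ → ModeSpace (Fin M)} {w : ℝ} (h : IsEnsemble v w ρ) (ξ : ℂ) :
    HasTrace (circuitOperator ρ ξ)
        (∑' s, ⟪v s, relParity M (displacement (fun _ => ξ) (v s))⟫_ℂ) ∧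
      HasTrace (ρ ∘L relParity M ∘L displacement fun _ : Fin M => ξ)
        (∑' s, ⟪v s, relParity M (displacement (fun _ => ξ) (v s))⟫_ℂ) := by
  refine ⟨?_, h.hasTrace (ContinuousLinearMap.id ℂ _) _⟩
  have h1 := h.hasTrace
    (qubitTensor !![0, 1; 1, 0] (displacement fun _ : Fin M => ξ) ∘L
        controlled (relParity M) ∘L diagonal _) (average _ ∘L (controlled (relParity M)).adjoint)
  have h2 := DFunLike.congr_fun (average_circuit (M := M) ξ)
  simp only [ContinuousLinearMap.comp_apply] at h1 h2
  simp only [h2] at h1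
  rw [circuitOperator, qubitTensor_plus]
  exact h1

theorem witnessMatrix_apply {M N : ℕ} {ρ : ModeSpace (Fin M) →L[ℂ] ModeSpace (Fin M)} {σ : Type}
    {v : σ → ModeSpace (Fin M)} {w : ℝ} (h : IsEnsemble v w ρ) (ξ : Fin N → ℂ) (n n' : Fin N) :
    witnessMatrix ρ ξ n n' = 1 / (N : ℂ) *
      ∑' s, ⟪v s, relParity M (displacement (fun _ => ξ n - ξ n') (v s))⟫_ℂ := by
  rw [witnessMatrix, Matrix.of_apply, (exists_hasTrace h _).2.trace_eq]

theorem isHermitian_witnessMatrix {M N : ℕ} {ρ : ModeSpace (Fin M) →L[ℂ] ModeSpace (Fin M)}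
    {σ : Type} {v : σ → ModeSpace (Fin M)} {w : ℝ} (h : IsEnsemble v w ρ) (ξ : Fin N → ℂ) :
    (witnessMatrix ρ ξ).IsHermitian := by
  ext n n'
  rw [Matrix.conjTranspose_apply, witnessMatrix_apply h, witnessMatrix_apply h, star_mul',
    Complex.star_def, Complex.conj_tsum]
  congr 1
  · simp
  · refine tsum_congr fun s => ?_
    have h1 : displacement (fun _ : Fin M => ξ n' - ξ n)
        = (displacement fun _ : Fin M => ξ n - ξ n').adjoint := by
      rw [adjoint_displacement]
      congr 1
      ext; simp
    have h2 := DFunLike.congr_fun (relParity_displacement (M := M) (ξ n - ξ n')) (v s)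
    simp only [ContinuousLinearMap.comp_apply] at h2
    rw [inner_conj_symm, h2, h1, ← adjoint_relParity, ContinuousLinearMap.adjoint_inner_left,
      ContinuousLinearMap.adjoint_inner_left, adjoint_relParity]

/-! ### Product vectors -/

/-- Rectangles form a π-system generating the product σ-algebra. Induction over it runs inside a box
of finite measure, where complements are harmless, and countably many boxes exhaust the space. -/
theorem ae_eq_zero_of_setIntegral_prod_eq_zero {X Y : Type} [MeasurableSpace X] [MeasurableSpace Y]
    {μ : Measure X} {ν : Measure Y} [SigmaFinite μ] [SigmaFinite ν] {h : X × Y → ℂ}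
    (hint : ∀ s t, MeasurableSet s → MeasurableSet t → μ s < ⊤ → ν t < ⊤ →
      IntegrableOn h (s ×ˢ t) (μ.prod ν))
    (h0 : ∀ s t, MeasurableSet s → MeasurableSet t → μ s < ⊤ → ν t < ⊤ →
      ∫ z in s ×ˢ t, h z ∂(μ.prod ν) = 0) : h =ᵐ[μ.prod ν] 0 := by
  set B : ℕ → Set (X × Y) := fun n => spanningSets μ n ×ˢ spanningSets ν n
  have hs : ∀ n, MeasurableSet (spanningSets μ n) := measurableSet_spanningSets μ
  have ht : ∀ n, MeasurableSet (spanningSets ν n) := measurableSet_spanningSets ν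
  have hsf : ∀ n, μ (spanningSets μ n) < ⊤ := measure_spanningSets_lt_top μ
  have htf : ∀ n, ν (spanningSets ν n) < ⊤ := measure_spanningSets_lt_top ν
  have hB : ∀ n, IntegrableOn h (B n) (μ.prod ν) := fun n => hint _ _ (hs n) (ht n) (hsf n) (htf n)
  have hB0 : ∀ n, ∫ z in B n, h z ∂(μ.prod ν) = 0 := fun n =>
    h0 _ _ (hs n) (ht n) (hsf n) (htf n)
  have key : ∀ n E, MeasurableSet E → ∫ z in E, h z ∂((μ.prod ν).restrict (B n)) = 0 := by
    intro n E hE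
    induction E, hE using MeasurableSpace.induction_on_inter generateFrom_prod.symm
      isPiSystem_prod with
    | empty => simp
    | basic E hE =>
      obtain ⟨s, hs', t, ht', rfl⟩ := hE
      rw [Measure.restrict_restrict (hs'.prod ht'), Set.prod_inter_prod]
      exact h0 _ _ (hs'.inter (hs n)) (ht'.inter (ht n))
        ((measure_mono Set.inter_subset_right).trans_lt (hsf n))
        ((measure_mono Set.inter_subset_right).trans_lt (htf n))
    | compl E hE ih => rw [setIntegral_compl hE (hB n), ih, hB0, sub_zero]
    | iUnion f hd hf ih =>
      rw [integral_iUnion hf hd (hB n).integrableOn]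
      simp [ih]
  have hcov : ⋃ n, B n = Set.univ := by
    refine Set.eq_univ_of_forall fun z => Set.mem_iUnion.2 ?_
    have h1 : z.1 ∈ ⋃ n, spanningSets μ n := by simp [iUnion_spanningSets]
    have h2 : z.2 ∈ ⋃ n, spanningSets ν n := by simp [iUnion_spanningSets]
    obtain ⟨i, hi⟩ := Set.mem_iUnion.1 h1
    obtain ⟨j, hj⟩ := Set.mem_iUnion.1 h2
    exact ⟨max i j, monotone_spanningSets μ (le_max_left i j) hi,
      monotone_spanningSets ν (le_max_right i j) hj⟩
  rw [← Measure.restrict_univ (μ := μ.prod ν), ← hcov]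
  exact (ae_restrict_iUnion_iff _ _).2 fun n =>
    Integrable.ae_eq_zero_of_forall_setIntegral_eq_zero (hB n) fun E hE _ => key n E hE

section Tensor

variable {M : ℕ} (A : Finset (Fin M))

/-- The splitting `ℝ^M ≃ ℝ^A × ℝ^Ā`. -/
def splitModes : (Fin M → ℝ) ≃ᵐ ({m // m ∈ A} → ℝ) × ({m // m ∉ A} → ℝ) :=
  MeasurableEquiv.piEquivPiSubtypeProd (fun _ => ℝ) (fun m => m ∈ A)

theorem splitModes_apply (x : Fin M → ℝ) :
    splitModes A x = (fun m : {m // m ∈ A} => x m, fun m : {m // m ∉ A} => x m) := rfl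

theorem measurePreserving_splitModes : MeasurePreserving (splitModes A) := by
  have e := volume_preserving_piEquivPiSubtypeProd (fun _ : Fin M => ℝ) (fun m => m ∈ A)
  convert e
  any_goals rfl

theorem coeFn_tensor (f : ModeSpace {m // m ∈ A}) (g : ModeSpace {m // m ∉ A}) :
    tensor A f g =ᵐ[volume] fun x => f (splitModes A x).1 * g (splitModes A x).2 :=
  (memLp_tensor A f g).coeFn_toLp

theorem inner_tensor (f f' : ModeSpace {m // m ∈ A}) (g g' : ModeSpace {m // m ∉ A}) :
    ⟪tensor A f g, tensor A f' g'⟫_ℂ = ⟪f, f'⟫_ℂ * ⟪g, g'⟫_ℂ := by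
  rw [L2.inner_def, L2.inner_def, L2.inner_def, ← integral_prod_mul, ← Measure.volume_eq_prod,
    ← (measurePreserving_splitModes A).integral_comp']
  refine integral_congr_ae ?_
  filter_upwards [coeFn_tensor A f g, coeFn_tensor A f' g'] with x h1 h2
  rw [h1, h2]
  simp only [RCLike.inner_apply, map_mul]
  ring

theorem norm_tensor (f : ModeSpace {m // m ∈ A}) (g : ModeSpace {m // m ∉ A}) :
    ‖tensor A f g‖ = ‖f‖ * ‖g‖ := by
  have h := inner_tensor A f f g g
  simp only [inner_self_eq_norm_sq_to_K] at h
  have h' : ‖tensor A f g‖ ^ 2 = (‖f‖ * ‖g‖) ^ 2 := by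
    rw [mul_pow]
    exact_mod_cast h
  exact (pow_left_inj₀ (norm_nonneg _) (by positivity) two_ne_zero).1 h'

theorem tensor_smul_left (c : ℂ) (f : ModeSpace {m // m ∈ A}) (g : ModeSpace {m // m ∉ A}) :
    tensor A (c • f) g = c • tensor A f g := by
  refine Lp.ext ?_
  have h1 := ((measurePreserving_splitModes A).quasiMeasurePreserving.ae
    (Measure.quasiMeasurePreserving_fst.ae (Lp.coeFn_smul c f)))
  filter_upwards [h1, coeFn_tensor A (c • f) g, coeFn_tensor A f g,
    Lp.coeFn_smul c (tensor A f g)] with x h1 h2 h3 h4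
  rw [h2, h4, h1, Pi.smul_apply, Pi.smul_apply, h3, smul_eq_mul, smul_eq_mul, mul_assoc]

/-- Product vectors are total. -/
theorem eq_zero_of_inner_tensor_eq_zero {h : ModeSpace (Fin M)}
    (h0 : ∀ f g, ⟪tensor A f g, h⟫_ℂ = 0) : h = 0 := by
  have hE := measurePreserving_splitModes A
  have hE' := hE.symm
  have hmem : MemLp (fun z => h ((splitModes A).symm z)) 2
      ((volume : Measure ({m // m ∈ A} → ℝ)).prod (volume : Measure ({m // m ∉ A} → ℝ))) :=
    (Lp.memLp h).comp_measurePreserving hE'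
  have key : (fun z => h ((splitModes A).symm z)) =ᵐ[
      (volume : Measure ({m // m ∈ A} → ℝ)).prod (volume : Measure ({m // m ∉ A} → ℝ))] 0 := by
    refine ae_eq_zero_of_setIntegral_prod_eq_zero (fun s t hs ht hsf htf => ?_)
      (fun s t hs ht hsf htf => ?_)
    · have : IsFiniteMeasure (((volume : Measure ({m // m ∈ A} → ℝ)).prod
          (volume : Measure ({m // m ∉ A} → ℝ))).restrict (s ×ˢ t)) :=
        ⟨by rw [Measure.restrict_apply_univ, Measure.prod_prod]; exact ENNReal.mul_lt_top hsf htf⟩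
      exact (hmem.restrict _).integrable one_le_two
    -- Orthogonality to the product of the indicators of s and t says that the integral over s × t
    -- vanishes.
    · rw [← integral_indicator (hs.prod ht), ← Measure.volume_eq_prod, ← hE.integral_comp',
        ← h0 (indicatorConstLp 2 hs hsf.ne 1) (indicatorConstLp 2 ht htf.ne 1), L2.inner_def]
      refine integral_congr_ae ?_
      have h1 := hE.quasiMeasurePreserving.ae (Measure.quasiMeasurePreserving_fst.ae
        (indicatorConstLp_coeFn (p := 2) (hs := hs) (hμs := hsf.ne) (c := (1 : ℂ))))
      have h2 := hE.quasiMeasurePreserving.ae (Measure.quasiMeasurePreserving_snd.ae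
        (indicatorConstLp_coeFn (p := 2) (hs := ht) (hμs := htf.ne) (c := (1 : ℂ))))
      filter_upwards [h1, h2, coeFn_tensor A (indicatorConstLp 2 hs hsf.ne 1)
        (indicatorConstLp 2 ht htf.ne 1)] with x h1 h2 h3
      rw [h3, h1, h2]
      by_cases hx1 : (splitModes A x).1 ∈ s <;> by_cases hx2 : (splitModes A x).2 ∈ t <;>
        simp [Set.indicator, Set.mem_prod, hx1, hx2]
  refine Lp.ext ?_
  filter_upwards [hE.quasiMeasurePreserving.ae key, Lp.coeFn_zero ℂ 2 volume] with x h1 h2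
  rw [MeasurableEquiv.symm_apply_apply] at h1
  rw [h1, h2]
  rfl

/-- Totality is used twice: to see that T - T' kills product vectors, and then that its adjoint is
zero. -/
theorem clm_ext_tensor {T T' : ModeSpace (Fin M) →L[ℂ] ModeSpace (Fin M)}
    (h : ∀ f g f' g', ⟪tensor A f g, T (tensor A f' g')⟫_ℂ = ⟪tensor A f g, T' (tensor A f' g')⟫_ℂ) :
    T = T' := by
  have h1 : ∀ f g, (T - T') (tensor A f g) = 0 := fun f' g' =>
    eq_zero_of_inner_tensor_eq_zero A fun f g => by simp [inner_sub_right, h]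
  have h2 : (T - T').adjoint = 0 := by
    ext1 x
    exact eq_zero_of_inner_tensor_eq_zero A fun f g => by
      rw [ContinuousLinearMap.adjoint_inner_right, h1, inner_zero_left]
  rw [← sub_eq_zero, ← ContinuousLinearMap.adjoint_adjoint (T - T'), h2, map_zero]

end Tensor

/-! ### Biseparable mixtures as ensembles of product vectors -/

/-- Tensoring ensembles of the two factors gives a summable family whose operator has the same
matrix elements as T between product vectors. -/
theorem IsProductState.exists_isEnsemble {M : ℕ} {A : Finset (Fin M)}
    {T : ModeSpace (Fin M) →L[ℂ] ModeSpace (Fin M)} (hT : IsProductState A T) :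
    ∃ (σ : Type) (φ : σ → ModeSpace {m // m ∈ A}) (χ : σ → ModeSpace {m // m ∉ A}),
      IsEnsemble (fun s => tensor A (φ s) (χ s)) 1 T := by
  obtain ⟨ρA, ρB, hA, hB, h⟩ := hT
  obtain ⟨σ, φ, hφ⟩ := CVWitness.exists_isEnsemble hA
  obtain ⟨τ, χ, hχ⟩ := CVWitness.exists_isEnsemble hB
  have hw : HasSum (fun p : σ × τ => ‖tensor A (φ p.1) (χ p.2)‖ ^ 2) 1 := by
    simp only [norm_tensor, mul_pow]
    have hs := hφ.hasSum_weight.summable.mul_of_nonneg hχ.hasSum_weight.summable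
      (fun _ => by positivity) (fun _ => by positivity)
    simpa using hφ.hasSum_weight.mul hχ.hasSum_weight hs
  obtain ⟨T', hT'⟩ := summable_rankOne hw.summable
  have hT'' : IsEnsemble (fun p : σ × τ => tensor A (φ p.1) (χ p.2)) 1 T' := ⟨hw, hT'⟩
  refine ⟨σ × τ, fun p => φ p.1, fun p => χ p.2, ?_⟩
  convert hT''
  refine clm_ext_tensor A fun f g f' g' => ?_
  rw [h, inner_tensor]
  have h1 := hφ.hasSum_inner f f'
  have h2 := hχ.hasSum_inner g g'
  have h3 := hT''.hasSum_inner (tensor A f g) (tensor A f' g')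
  refine HasSum.unique (h1.mul h2 ?_) ?_
  · refine h3.summable.congr fun p => ?_
    simp only [inner_tensor]
    ring
  · convert! h3 using 1
    funext p
    simp only [inner_tensor]
    ring

/-- The weight p k is absorbed as √(p k) into the first factor, which keeps every vector a product;
the ensembles are then joined over k. -/
theorem IsBiseparableMixture.exists_isEnsemble {M : ℕ}
    {ρ : ModeSpace (Fin M) →L[ℂ] ModeSpace (Fin M)} (hρ : IsBiseparableMixture ρ) :
    ∃ (σ : Type) (A : σ → Finset (Fin M)) (φ : ∀ s, ModeSpace {m // m ∈ A s})
      (χ : ∀ s, ModeSpace {m // m ∉ A s}), (∀ s, (A s).Nonempty ∧ (A s)ᶜ.Nonempty) ∧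
      IsEnsemble (fun s => tensor (A s) (φ s) (χ s)) 1 ρ := by
  obtain ⟨p, A, T, hp, hp1, hT, hρ⟩ := hρ
  choose σ φ χ h using fun k => (hT k).2.2.exists_isEnsemble
  have hk : ∀ k s, tensor (A k) (((√(p k) : ℝ) : ℂ) • φ k s) (χ k s)
      = ((√(p k) : ℝ) : ℂ) • tensor (A k) (φ k s) (χ k s) := fun k s => tensor_smul_left _ _ _ _
  have hn : ∀ k s, ‖tensor (A k) (((√(p k) : ℝ) : ℂ) • φ k s) (χ k s)‖ ^ 2
      = p k * ‖tensor (A k) (φ k s) (χ k s)‖ ^ 2 := fun k s => by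
    rw [hk, norm_smul, mul_pow, Complex.norm_real, Real.norm_eq_abs, sq_abs, Real.sq_sqrt (hp k)]
  have hr : ∀ k s, InnerProductSpace.rankOne ℂ (tensor (A k) (((√(p k) : ℝ) : ℂ) • φ k s) (χ k s))
      (tensor (A k) (((√(p k) : ℝ) : ℂ) • φ k s) (χ k s)) = (p k : ℂ) •
      InnerProductSpace.rankOne ℂ (tensor (A k) (φ k s) (χ k s))
        (tensor (A k) (φ k s) (χ k s)) := fun k s => by
    have : ((√(p k) : ℝ) : ℂ) * ((√(p k) : ℝ) : ℂ) = p k := by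
      rw [← Complex.ofReal_mul, Real.mul_self_sqrt (hp k)]
    rw [hk]
    ext1 f
    simp only [smul_apply, InnerProductSpace.rankOne_apply, inner_smul_left, Complex.conj_ofReal,
      smul_smul, ← this]
    congr 1
    ring
  have hw : ∀ k, HasSum (fun s => ‖tensor (A k) (((√(p k) : ℝ) : ℂ) • φ k s) (χ k s)‖ ^ 2) (p k) :=
    fun k => by simpa only [hn, mul_one] using (h k).hasSum_weight.mul_left (p k)
  have hsum : Summable fun s : Σ k, σ k =>
      ‖tensor (A s.1) (((√(p s.1) : ℝ) : ℂ) • φ s.1 s.2) (χ s.1 s.2)‖ ^ 2 := by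
    refine (summable_sigma_of_nonneg fun _ => by positivity).2 ⟨fun k => (hw k).summable, ?_⟩
    simpa only [(hw _).tsum_eq] using hp1.summable
  refine ⟨Σ k, σ k, fun s => A s.1, fun s => ((√(p s.1) : ℝ) : ℂ) • φ s.1 s.2, fun s => χ s.1 s.2,
    fun s => ⟨(hT s.1).1, (hT s.1).2.1⟩, hp1.sigma_of_hasSum hw hsum,
    hρ.sigma_of_hasSum (fun k => ?_) (summable_rankOne hsum)⟩
  simp only [hr]
  exact (h k).hasSum.const_smul _

/-! ### Coordinates adapted to the total position of a block of modes -/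

/-- Regroups two block totals and two sets of remaining coordinates block by block, as `ofTotal`
expects. -/
theorem measurePreserving_prodProdProdSwap {X Y Z W : Type} [MeasureSpace X] [MeasureSpace Y]
    [MeasureSpace Z] [MeasureSpace W] [SFinite (volume : Measure X)] [SFinite (volume : Measure Y)]
    [SFinite (volume : Measure Z)] [SFinite (volume : Measure W)] :
    MeasurePreserving (fun p : (X × Y) × (Z × W) => ((p.2.1, p.1.1), (p.2.2, p.1.2))) := by
  have h1 : MeasurePreserving (MeasurableEquiv.prodAssoc : (X × Y) × (Z × W) ≃ᵐ _) :=
    volume_preserving_prodAssoc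
  have h2 : MeasurePreserving (MeasurableEquiv.prodAssoc : (Y × Z) × W ≃ᵐ _) :=
    volume_preserving_prodAssoc
  have h3 : MeasurePreserving (MeasurableEquiv.prodAssoc : (Z × Y) × W ≃ᵐ _) :=
    volume_preserving_prodAssoc
  have h4 : MeasurePreserving (MeasurableEquiv.prodAssoc : (X × Z) × (Y × W) ≃ᵐ _) :=
    volume_preserving_prodAssoc
  have hX := MeasurePreserving.id (volume : Measure X)
  have hW := MeasurePreserving.id (volume : Measure W)
  have s1 : MeasurePreserving (Prod.swap : Y × Z → Z × Y) := Measure.measurePreserving_swap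
  have s2 : MeasurePreserving (Prod.swap : X × Z → Z × X) := Measure.measurePreserving_swap
  have s3 : MeasurePreserving (Prod.swap : Y × W → W × Y) := Measure.measurePreserving_swap
  exact (s2.prod s3).comp (h4.symm.comp ((hX.prod h3).comp ((hX.prod (s1.prod hW)).comp
    ((hX.prod h2.symm).comp h1))))

theorem map_linear_prod_real {a b c d : ℝ} (h : a * d - b * c ≠ 0) :
    Measure.map (fun p : ℝ × ℝ => (a * p.1 + b * p.2, c * p.1 + d * p.2)) volume =
      ENNReal.ofReal |(a * d - b * c)⁻¹| • volume := by
  let L : ℝ × ℝ →ₗ[ℝ] ℝ × ℝ :=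
    Matrix.toLin (Module.Basis.finTwoProd ℝ) (Module.Basis.finTwoProd ℝ) !![a, b; c, d]
  have hL : ⇑L = fun p : ℝ × ℝ => (a * p.1 + b * p.2, c * p.1 + d * p.2) := by
    ext p <;> simp [L, Matrix.toLin_finTwoProd_apply]
  have hd : LinearMap.det L = a * d - b * c := by
    simp [L, Matrix.det_fin_two]
  rw [← hL, ← hd]
  exact Measure.map_linearMap_addHaar_eq_smul_addHaar volume (by rwa [hd])

section Coordinates

variable {ι : Type} [Fintype ι] [DecidableEq ι] (i₀ : ι)

/-- The point of `ℝ^ι` with total position `r` whose coordinates other than `i₀` are `z`. -/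
def ofTotal (p : ({i // i ≠ i₀} → ℝ) × ℝ) (i : ι) : ℝ :=
  if h : i ≠ i₀ then p.1 ⟨i, h⟩ else p.2 - ∑ j, p.1 j

theorem sum_eq_add_sum_ne (x : ι → ℝ) : ∑ i, x i = x i₀ + ∑ j : {i // i ≠ i₀}, x j := by
  rw [Fintype.sum_eq_add_sum_compl i₀, ← Finset.sum_subtype {i₀}ᶜ (by simp) x]

theorem sum_ofTotal (p : ({i // i ≠ i₀} → ℝ) × ℝ) : ∑ i, ofTotal i₀ p i = p.2 := by
  rw [sum_eq_add_sum_ne i₀]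
  have : ∀ j : {i // i ≠ i₀}, ofTotal i₀ p j = p.1 j := fun j => by simp [ofTotal, j.2]
  simp only [this]
  simp [ofTotal]

/-- Reflecting a point of `ℝ^ι` at the diagonal point with coordinates `y`. -/
theorem const_sub_ofTotal (y : ℝ) (p : ({i // i ≠ i₀} → ℝ) × ℝ) :
    (fun _ => 2 * y) - ofTotal i₀ p
      = ofTotal i₀ ((fun _ => 2 * y) - p.1, 2 * Fintype.card ι * y - p.2) := by
  have hc : (Fintype.card {i // i ≠ i₀} : ℝ) = Fintype.card ι - 1 := by
    have := sum_eq_add_sum_ne i₀ fun _ => (1 : ℝ)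
    simp at this
    simp [this]
  ext i
  by_cases h : i ≠ i₀
  · simp [ofTotal, h]
  · simp only [ofTotal, h, Pi.sub_apply, Finset.sum_sub_distrib, dite_false, Finset.sum_const,
      Finset.card_univ, nsmul_eq_mul, hc]
    ring

theorem measurable_ofTotal : Measurable (ofTotal i₀) := by
  refine measurable_pi_lambda _ fun i => ?_
  by_cases h : i ≠ i₀
  · simp only [ofTotal, h, ne_eq, not_false_eq_true, dite_true]
    fun_prop
  · simp only [ofTotal, h, dite_false]
    fun_prop

/-- For fixed other coordinates, passing from the total to the coordinate i₀ is a translation, so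
the map is a shear. -/
theorem measurePreserving_ofTotal : MeasurePreserving (ofTotal i₀) := by
  have : Unique {i // ¬ i ≠ i₀} :=
    ⟨⟨⟨i₀, by simp⟩⟩, fun j => Subtype.ext (not_not.1 j.2)⟩
  have h1 := (volume_preserving_piEquivPiSubtypeProd (fun _ : ι => ℝ) (fun i => i ≠ i₀)).symm
  have h2 := (volume_preserving_funUnique {i // ¬ i ≠ i₀} ℝ).symm
  rw [Subsingleton.elim (Unique.fintype : Fintype {i // ¬ i ≠ i₀}) (Subtype.fintype _)] at h2
  have h3 : MeasurePreserving (fun p : ({i // i ≠ i₀} → ℝ) × ℝ => (p.1, p.2 - ∑ j, p.1 j)) :=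
    (MeasurePreserving.id volume).skew_product 
      (g := fun (z : {i // i ≠ i₀} → ℝ) (r : ℝ) => r - ∑ j, z j) (by fun_prop)
      (.of_forall fun z => map_sub_right_eq_self volume _)
  have h4 := h1.comp (((MeasurePreserving.id volume).prod h2).comp h3)
  convert! h4 using 1

end Coordinates

/-! ### Fibrewise correlations -/

theorem sq_lintegral_mul_le {X : Type} [MeasurableSpace X] {μ : Measure X} {f g : X → ENNReal}
    (hf : AEMeasurable f μ) (hg : AEMeasurable g μ) :
    (∫⁻ x, f x * g x ∂μ) ^ 2 ≤ (∫⁻ x, f x ^ 2 ∂μ) * ∫⁻ x, g x ^ 2 ∂μ := by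
  have h := ENNReal.lintegral_mul_le_Lp_mul_Lq μ Real.HolderConjugate.two_two hf hg
  simp only [ENNReal.rpow_two, Pi.mul_apply] at h
  calc _ ≤ ((∫⁻ x, f x ^ 2 ∂μ) ^ (1 / 2 : ℝ) * (∫⁻ x, g x ^ 2 ∂μ) ^ (1 / 2 : ℝ)) ^ 2 := by gcongr
    _ = _ := by
      rw [mul_pow, ← ENNReal.rpow_two, ← ENNReal.rpow_two, ← ENNReal.rpow_mul, ← ENNReal.rpow_mul]
      norm_num

section Correlation

variable {ι : Type} [Fintype ι] [DecidableEq ι] (i₀ : ι)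

/-- The partial Wigner correlation of `φ` at the diagonal point `y`: the integral of
`x ↦ φ(x)* φ(2y - x)` over the fibre on which the total position is `|ι| y + s`. -/
def fibreCorr (φ : (ι → ℝ) → ℂ) (p : ℝ × ℝ) : ℂ :=
  ∫ z : {i // i ≠ i₀} → ℝ, conj (φ (ofTotal i₀ (z, Fintype.card ι * p.1 + p.2))) *
    φ ((fun _ => 2 * p.1) - ofTotal i₀ (z, Fintype.card ι * p.1 + p.2))

theorem stronglyMeasurable_fibreCorr {φ : (ι → ℝ) → ℂ} (hφ : Measurable φ) :
    StronglyMeasurable (fibreCorr i₀ φ) := by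
  have h := measurable_ofTotal i₀
  refine StronglyMeasurable.integral_prod_right' (f := fun q : (ℝ × ℝ) × ({i // i ≠ i₀} → ℝ) =>
    conj (φ (ofTotal i₀ (q.2, Fintype.card ι * q.1.1 + q.1.2))) *
      φ ((fun _ => 2 * q.1.1) - ofTotal i₀ (q.2, Fintype.card ι * q.1.1 + q.1.2))) ?_
  refine Measurable.stronglyMeasurable (.mul ?_ ?_)
  · exact Complex.continuous_conj.measurable.comp (by fun_prop)
  · fun_prop

/-- The mass of `|φ|²` on the fibre with total position `r`. -/
def fibreMass (φ : (ι → ℝ) → ℂ) (r : ℝ) : ENNReal :=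
  ∫⁻ z : {i // i ≠ i₀} → ℝ, ‖φ (ofTotal i₀ (z, r))‖ₑ ^ 2

theorem measurable_fibreMass {φ : (ι → ℝ) → ℂ} (hφ : Measurable φ) :
    Measurable (fibreMass i₀ φ) := by
  have h := measurable_ofTotal i₀
  exact Measurable.lintegral_prod_right' (f := fun q : ℝ × ({i // i ≠ i₀} → ℝ) =>
    ‖φ (ofTotal i₀ (q.2, q.1))‖ₑ ^ 2) (by fun_prop)

theorem lintegral_fibreMass {φ : (ι → ℝ) → ℂ} (hφ : Measurable φ) :
    ∫⁻ r, fibreMass i₀ φ r = ∫⁻ x, ‖φ x‖ₑ ^ 2 := by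
  have h := measurable_ofTotal i₀
  rw [← (measurePreserving_ofTotal i₀).lintegral_comp (f := fun x => ‖φ x‖ₑ ^ 2) (by fun_prop),
    Measure.volume_eq_prod, lintegral_prod_symm' _ (by fun_prop)]
  rfl

/-- Cauchy–Schwarz on the fibre. Reflection in the point y·1 sends the total |ι| y + s to |ι| y - s
and acts on the fibre coordinates by a measure preserving reflection. -/
theorem sq_enorm_fibreCorr_le {φ : (ι → ℝ) → ℂ} (hφ : Measurable φ) (p : ℝ × ℝ) :
    ‖fibreCorr i₀ φ p‖ₑ ^ 2 ≤ fibreMass i₀ φ (Fintype.card ι * p.1 + 1 * p.2) *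
      fibreMass i₀ φ (Fintype.card ι * p.1 + (-1) * p.2) := by
  have h := measurable_ofTotal i₀
  have h2 : ∀ r, ∫⁻ z : {i // i ≠ i₀} → ℝ, ‖φ (ofTotal i₀ ((fun _ => 2 * p.1) - z, r))‖ₑ ^ 2
      = fibreMass i₀ φ r := fun r =>
    lintegral_sub_left_eq_self (fun z => ‖φ (ofTotal i₀ (z, r))‖ₑ ^ 2) _
  rw [one_mul, ← h2 (Fintype.card ι * p.1 + (-1) * p.2), fibreMass]
  refine le_trans ?_ (sq_lintegral_mul_le (by fun_prop) (by fun_prop))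
  gcongr
  refine (enorm_integral_le_lintegral_enorm _).trans (le_of_eq (lintegral_congr fun z => ?_))
  rw [enorm_mul, RCLike.enorm_conj, const_sub_ofTotal]
  congr 5
  ring

/-- The map (y, s) ↦ (|ι| y + s, |ι| y - s) has determinant -2|ι|, and in the new variables the
product of masses integrates to the square of the total mass. -/
theorem lintegral_sq_fibreCorr_le [Nonempty ι] {φ : (ι → ℝ) → ℂ} (hφ : Measurable φ) :
    ∫⁻ p, ‖fibreCorr i₀ φ p‖ₑ ^ 2 ≤
      ENNReal.ofReal (1 / (2 * Fintype.card ι)) * (∫⁻ x, ‖φ x‖ₑ ^ 2) ^ 2 := by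
  have hm := measurable_fibreMass i₀ hφ
  have hc : (0 : ℝ) < Fintype.card ι := by exact_mod_cast Fintype.card_pos
  have hle := lintegral_mono (μ := volume) fun p => sq_enorm_fibreCorr_le i₀ hφ p
  have hd : (Fintype.card ι : ℝ) * (-1) - 1 * Fintype.card ι = -(2 * Fintype.card ι) := by ring
  generalize (Fintype.card ι : ℝ) = c at hc hd hle ⊢
  have hmap := map_linear_prod_real (a := c) (b := 1) (c := c) (d := -1)
    (by rw [hd]; exact neg_ne_zero.2 (by positivity))
  have hF : Measurable fun p : ℝ × ℝ => fibreMass i₀ φ p.1 * fibreMass i₀ φ p.2 := by fun_prop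
  have hL : Measurable fun p : ℝ × ℝ => (c * p.1 + 1 * p.2, c * p.1 + (-1) * p.2) := by fun_prop
  refine hle.trans (le_of_eq ?_)
  rw [← lintegral_map hF hL, hmap, lintegral_smul_measure, Measure.volume_eq_prod,
    lintegral_prod_mul hm.aemeasurable hm.aemeasurable, lintegral_fibreMass i₀ hφ, ← pow_two,
    smul_eq_mul, hd, abs_inv, abs_neg, abs_of_pos (by positivity), one_div]

end Correlation

/-! ### Pairing square integrable families with a contraction -/

/-- Contractivity of U is applied pointwise under the integral, followed by Cauchy–Schwarz in x;
each factor N counts the members of one family. -/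
theorem enorm_sum_integral_le {X : Type} [MeasurableSpace X] {μ : Measure X} {N : ℕ}
    {U : Matrix (Fin N) (Fin N) ℂ} (hU : IsBilinContraction U) {a b : Fin N → X → ℂ}
    (ha : ∀ n, AEStronglyMeasurable (a n) μ) (hb : ∀ n, AEStronglyMeasurable (b n) μ)
    (hab : ∀ n n', Integrable (fun x => a n x * b n' x) μ)
    {Ka Kb : ENNReal} (hKa : ∀ n, ∫⁻ x, ‖a n x‖ₑ ^ 2 ∂μ ≤ Ka)
    (hKb : ∀ n, ∫⁻ x, ‖b n x‖ₑ ^ 2 ∂μ ≤ Kb) :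
    ‖∑ n, ∑ n', U n n' * ∫ x, a n x * b n' x ∂μ‖ₑ ^ 2 ≤ (N * Ka) * (N * Kb) := by
  have h1 : ∑ n, ∑ n', U n n' * ∫ x, a n x * b n' x ∂μ
      = ∫ x, ∑ n, ∑ n', U n n' * (a n x * b n' x) ∂μ := by
    have hI := fun n n' => (hab n n').const_mul (U n n')
    symm
    exact (integral_finsetSum _ fun n _ => integrable_finsetSum _ fun n' _ => hI n n').trans
      (Finset.sum_congr rfl fun n _ => (integral_finsetSum _ fun n' _ => hI n n').trans
        (Finset.sum_congr rfl fun n' _ => integral_const_mul _ _))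
  have hsq : ∀ (c : Fin N → X → ℂ) x, ENNReal.ofReal √(∑ n, ‖c n x‖ ^ 2) ^ 2
      = ∑ n, ‖c n x‖ₑ ^ 2 := fun c x => by
    rw [← ENNReal.ofReal_pow (Real.sqrt_nonneg _), Real.sq_sqrt (by positivity),
      ENNReal.ofReal_sum_of_nonneg fun _ _ => by positivity]
    exact Finset.sum_congr rfl fun n _ => by
      rw [ENNReal.ofReal_pow (norm_nonneg _), ofReal_norm]
  have hK : ∀ (c : Fin N → X → ℂ) (K : ENNReal), (∀ n, AEStronglyMeasurable (c n) μ) →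
      (∀ n, ∫⁻ x, ‖c n x‖ₑ ^ 2 ∂μ ≤ K) →
      ∫⁻ x, ENNReal.ofReal √(∑ n, ‖c n x‖ ^ 2) ^ 2 ∂μ ≤ N * K := fun c K hc hK => by
    simp only [hsq]
    rw [lintegral_finsetSum' _ fun n _ => (hc n).enorm.pow_const 2]
    simpa using Finset.sum_le_card_nsmul Finset.univ _ K fun n _ => hK n
  have hm : ∀ (c : Fin N → X → ℂ), (∀ n, AEStronglyMeasurable (c n) μ) →
      AEMeasurable (fun x => ENNReal.ofReal √(∑ n, ‖c n x‖ ^ 2)) μ := fun c hc =>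
    (Finset.aemeasurable_fun_sum _ fun n _ => (hc n).norm.aemeasurable.pow_const 2).sqrt.ennreal_ofReal
  calc _ ≤ (∫⁻ x, ENNReal.ofReal √(∑ n, ‖a n x‖ ^ 2) * ENNReal.ofReal √(∑ n, ‖b n x‖ ^ 2) ∂μ) ^ 2 := by
        rw [h1]
        gcongr
        refine (enorm_integral_le_lintegral_enorm _).trans (lintegral_mono fun x => ?_)
        rw [← ENNReal.ofReal_mul (Real.sqrt_nonneg _), ← ofReal_norm]
        exact ENNReal.ofReal_le_ofReal (hU (fun n => a n x) fun n => b n x)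
    _ ≤ _ := sq_lintegral_mul_le (hm a ha) (hm b hb)
    _ ≤ _ := mul_le_mul' (hK a Ka ha hKa) (hK b Kb hb hKb)

/-! ### Matrix elements of a product vector -/

section Bipartite

variable {ι κ : Type} [Fintype ι] [DecidableEq ι] [Fintype κ] [DecidableEq κ] (i₀ : ι) (k₀ : κ)

/-- The coordinates `((y, s), (z, w))` of two blocks of modes: the blocks have total positions
`|ι| y + s` and `|κ| y + c - s`. -/
def blockCoord (c : ℝ) (q : (ℝ × ℝ) × (({i // i ≠ i₀} → ℝ) × ({k // k ≠ k₀} → ℝ))) :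
    (ι → ℝ) × (κ → ℝ) :=
  (ofTotal i₀ (q.2.1, Fintype.card ι * q.1.1 + q.1.2),
    ofTotal k₀ (q.2.2, Fintype.card κ * q.1.1 + (c - q.1.2)))

theorem measurable_blockCoord (c : ℝ) : Measurable (blockCoord i₀ k₀ c) := by
  have h := measurable_ofTotal i₀
  have h' := measurable_ofTotal k₀
  unfold blockCoord
  fun_prop

/-- The map from (y, s) to the two block totals has linear part of determinant -(|ι| + |κ|);
everything else preserves volume. -/
theorem map_blockCoord (c : ℝ) :
    Measure.map (blockCoord i₀ k₀ c) volume =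
      ENNReal.ofReal (1 / (Fintype.card ι + Fintype.card κ)) • volume := by
  have : Nonempty ι := ⟨i₀⟩
  have hm : (0 : ℝ) < Fintype.card ι := by exact_mod_cast Fintype.card_pos
  have hl : (0 : ℝ) ≤ Fintype.card κ := by positivity
  have hd : (Fintype.card ι : ℝ) * (-1) - 1 * Fintype.card κ
      = -(Fintype.card ι + Fintype.card κ) := by ring
  have hL := map_linear_prod_real (a := Fintype.card ι) (b := 1) (c := Fintype.card κ) (d := -1)
    (by rw [hd]; exact neg_ne_zero.2 (by positivity))
  rw [hd, abs_inv, abs_neg, abs_of_pos (by positivity), ← one_div] at hL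
  set L : ℝ × ℝ → ℝ × ℝ := fun p =>
    (Fintype.card ι * p.1 + 1 * p.2, Fintype.card κ * p.1 + (-1) * p.2)
  have hLm : Measurable L := by fun_prop
  have hT : MeasurePreserving (fun p : ℝ × ℝ => p + (0, c)) :=
    measurePreserving_add_right volume _
  have hP := (((measurePreserving_ofTotal i₀).prod (measurePreserving_ofTotal k₀)).comp
    measurePreserving_prodProdProdSwap).comp (hT.prod (MeasurePreserving.id
      (volume : Measure (({i // i ≠ i₀} → ℝ) × ({k // k ≠ k₀} → ℝ)))))
  have hmap : Measure.map (Prod.map L (id : ({i // i ≠ i₀} → ℝ) × ({k // k ≠ k₀} → ℝ) → _)) volume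
      = ENNReal.ofReal (1 / (Fintype.card ι + Fintype.card κ)) • volume := by
    rw [Measure.volume_eq_prod, ← Measure.map_prod_map _ _ hLm measurable_id, hL, Measure.map_id,
      Measure.prod_smul_left]
  have hcomp : blockCoord i₀ k₀ c = ((Prod.map (ofTotal i₀) (ofTotal k₀) ∘
      fun p => ((p.2.1, p.1.1), (p.2.2, p.1.2))) ∘ Prod.map (fun p : ℝ × ℝ => p + (0, c)) id) ∘
      Prod.map L id := by
    ext1 q
    refine Prod.ext (congrArg (ofTotal i₀) (Prod.ext rfl ?_))
      (congrArg (ofTotal k₀) (Prod.ext rfl ?_))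
    · change _ = (Fintype.card ι * q.1.1 + 1 * q.1.2) + 0
      ring
    · change _ = (Fintype.card κ * q.1.1 + (-1) * q.1.2) + c
      ring
  rw [hcomp, ← Measure.map_map hP.measurable (by fun_prop), hmap, Measure.map_smul]
  congr 1
  exact hP.map_eq

/-- The integrand of the matrix element `⟨φ ⊗ χ, Π D(ξ) (φ ⊗ χ)⟩` with `q = √2 Re ξ`,
`p = √2 Im ξ`. -/
def blockIntegrand (φ : (ι → ℝ) → ℂ) (χ : (κ → ℝ) → ℂ) (q p : ℝ) (x : (ι → ℝ) × (κ → ℝ)) : ℂ :=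
  conj (φ x.1 * χ x.2) *
    (Complex.exp (((p * (∑ i, x.1 i + ∑ k, x.2 k - (Fintype.card ι + Fintype.card κ) * q / 2) : ℝ) :
      ℂ) * Complex.I) *
    (φ ((fun _ => 2 / (Fintype.card ι + Fintype.card κ) * (∑ i, x.1 i + ∑ k, x.2 k) - q) - x.1) *
      χ ((fun _ => 2 / (Fintype.card ι + Fintype.card κ) * (∑ i, x.1 i + ∑ k, x.2 k) - q) - x.2)))

/-- The offset c = (|ι| + |κ|) q / 2 is chosen so that both blocks are reflected in the same
diagonal point y and the phase depends on y alone. -/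
theorem blockIntegrand_blockCoord (φ : (ι → ℝ) → ℂ) (χ : (κ → ℝ) → ℂ) (q p : ℝ)
    (t : (ℝ × ℝ) × (({i // i ≠ i₀} → ℝ) × ({k // k ≠ k₀} → ℝ))) :
    blockIntegrand φ χ q p
        (blockCoord i₀ k₀ ((Fintype.card ι + Fintype.card κ) * q / 2) t) =
      Complex.exp (((p * ((Fintype.card ι + Fintype.card κ) * t.1.1) : ℝ) : ℂ) * Complex.I) *
      ((conj (φ (ofTotal i₀ (t.2.1, Fintype.card ι * t.1.1 + t.1.2))) *
        φ ((fun _ => 2 * t.1.1) - ofTotal i₀ (t.2.1, Fintype.card ι * t.1.1 + t.1.2))) *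
      (conj (χ (ofTotal k₀ (t.2.2, Fintype.card κ * t.1.1 +
          ((Fintype.card ι + Fintype.card κ) * q / 2 - t.1.2)))) *
        χ ((fun _ => 2 * t.1.1) - ofTotal k₀ (t.2.2, Fintype.card κ * t.1.1 +
          ((Fintype.card ι + Fintype.card κ) * q / 2 - t.1.2))))) := by
  have : Nonempty ι := ⟨i₀⟩
  have hm : (0 : ℝ) < Fintype.card ι := by exact_mod_cast Fintype.card_pos
  have hl : (0 : ℝ) ≤ Fintype.card κ := by positivity
  have h0 : (Fintype.card ι + Fintype.card κ : ℝ) ≠ 0 := by positivity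
  have h1 : p * ((Fintype.card ι * t.1.1 + t.1.2) + (Fintype.card κ * t.1.1 +
      ((Fintype.card ι + Fintype.card κ) * q / 2 - t.1.2)) -
        (Fintype.card ι + Fintype.card κ) * q / 2)
      = p * ((Fintype.card ι + Fintype.card κ) * t.1.1) := by ring
  have h2 : 2 / (Fintype.card ι + Fintype.card κ : ℝ) * ((Fintype.card ι * t.1.1 + t.1.2) +
      (Fintype.card κ * t.1.1 + ((Fintype.card ι + Fintype.card κ) * q / 2 - t.1.2))) - q
      = 2 * t.1.1 := by
    field_simp
    ring
  simp only [blockIntegrand, blockCoord, sum_ofTotal, h1, h2, map_mul]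
  ring

/-- For fixed (y, s) the integrand is a product over the two fibres, so Fubini leaves a product of
fibre correlations; the prefactor is the Jacobian. -/
theorem integral_blockIntegrand {φ : (ι → ℝ) → ℂ} {χ : (κ → ℝ) → ℂ} {q p : ℝ}
    (hint : Integrable (blockIntegrand φ χ q p)) :
    Integrable (fun t : ℝ × ℝ =>
      Complex.exp (((p * ((Fintype.card ι + Fintype.card κ) * t.1) : ℝ) : ℂ) * Complex.I) *
        (fibreCorr i₀ φ t *
          fibreCorr k₀ χ (t.1, (Fintype.card ι + Fintype.card κ) * q / 2 - t.2))) ∧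
    ∫ x, blockIntegrand φ χ q p x = ((Fintype.card ι + Fintype.card κ : ℝ) : ℂ) * ∫ t : ℝ × ℝ,
      Complex.exp (((p * ((Fintype.card ι + Fintype.card κ) * t.1) : ℝ) : ℂ) * Complex.I) *
        (fibreCorr i₀ φ t *
          fibreCorr k₀ χ (t.1, (Fintype.card ι + Fintype.card κ) * q / 2 - t.2)) := by
  have : Nonempty ι := ⟨i₀⟩
  have hm : (0 : ℝ) < Fintype.card ι := by exact_mod_cast Fintype.card_pos
  have hl : (0 : ℝ) ≤ Fintype.card κ := by positivity
  have h0 : (Fintype.card ι + Fintype.card κ : ℝ) ≠ 0 := by positivity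
  set c : ℝ := (Fintype.card ι + Fintype.card κ) * q / 2 with hc
  have hΦ := measurable_blockCoord i₀ k₀ c
  have hmap := map_blockCoord i₀ k₀ c
  have hI : Integrable (blockIntegrand φ χ q p) (Measure.map (blockCoord i₀ k₀ c) volume) := by
    rw [hmap]
    exact hint.smul_measure ENNReal.ofReal_ne_top
  have hval := integral_map hΦ.aemeasurable hI.aestronglyMeasurable
  have hI' := hI.comp_measurable hΦ
  rw [hmap, integral_smul_measure, ENNReal.toReal_ofReal (by positivity), Complex.real_smul] at hval
  have hinner : ∀ t : ℝ × ℝ, ∫ z, blockIntegrand φ χ q p (blockCoord i₀ k₀ c (t, z)) =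
      Complex.exp (((p * ((Fintype.card ι + Fintype.card κ) * t.1) : ℝ) : ℂ) * Complex.I) *
        (fibreCorr i₀ φ t * fibreCorr k₀ χ (t.1, c - t.2)) := by
    intro t
    simp only [hc, blockIntegrand_blockCoord]
    rw [integral_const_mul, Measure.volume_eq_prod]
    congr 1
    exact integral_prod_mul (fun z : {i // i ≠ i₀} → ℝ =>
        conj (φ (ofTotal i₀ (z, Fintype.card ι * t.1 + t.2))) *
          φ ((fun _ => 2 * t.1) - ofTotal i₀ (z, Fintype.card ι * t.1 + t.2)))
      (fun z : {k // k ≠ k₀} → ℝ =>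
        conj (χ (ofTotal k₀ (z, Fintype.card κ * t.1 + (c - t.2)))) *
          χ ((fun _ => 2 * t.1) - ofTotal k₀ (z, Fintype.card κ * t.1 + (c - t.2))))
  simp only [← hinner]
  refine ⟨Integrable.integral_prod_left (μ := volume) (ν := volume) hI', ?_⟩
  calc _ = ((Fintype.card ι + Fintype.card κ : ℝ) : ℂ) *
        ∫ t, blockIntegrand φ χ q p (blockCoord i₀ k₀ c t) := by
        rw [← hval, ← mul_assoc, ← Complex.ofReal_mul, mul_one_div_cancel h0, Complex.ofReal_one,
          one_mul]
    _ = _ := congrArg _ (integral_prod (μ := volume) (ν := volume) _ hI')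

end Bipartite

section Bipartite

variable {ι κ : Type} [Fintype ι] [DecidableEq ι] [Fintype κ] [DecidableEq κ]

theorem norm_sum_blockIntegrand_le [Nonempty ι] [Nonempty κ] {N : ℕ}
    {U : Matrix (Fin N) (Fin N) ℂ} (hU : IsBilinContraction U) {φ : (ι → ℝ) → ℂ} {χ : (κ → ℝ) → ℂ}
    (hφ : Measurable φ) (hχ : Measurable χ) {w w' : ℝ} (hw0 : 0 ≤ w) (hw0' : 0 ≤ w')
    (hw : ∫⁻ x, ‖φ x‖ₑ ^ 2 = ENNReal.ofReal w) (hw' : ∫⁻ x, ‖χ x‖ₑ ^ 2 = ENNReal.ofReal w')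
    (q p : Fin N → ℝ)
    (hint : ∀ n n', Integrable (blockIntegrand φ χ (q n - q n') (p n - p n'))) :
    ‖∑ n, ∑ n', U n n' * ∫ x, blockIntegrand φ χ (q n - q n') (p n - p n') x‖ ≤
      N * ((Fintype.card ι + Fintype.card κ) / (2 * √(Fintype.card ι * Fintype.card κ)) *
        (w * w')) := by
  obtain ⟨i₀⟩ := ‹Nonempty ι›
  obtain ⟨k₀⟩ := ‹Nonempty κ›
  have hι : Nonempty ι := ⟨i₀⟩
  have hκ : Nonempty κ := ⟨k₀⟩
  have hgA := lintegral_sq_fibreCorr_le i₀ hφ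
  have hgB := lintegral_sq_fibreCorr_le k₀ hχ
  have hAm := stronglyMeasurable_fibreCorr i₀ hφ
  have hBm := stronglyMeasurable_fibreCorr k₀ hχ
  have hI := fun n n' => integral_blockIntegrand i₀ k₀ (hint n n')
  have hm : (0 : ℝ) < Fintype.card ι := by exact_mod_cast Fintype.card_pos
  have hl : (0 : ℝ) < Fintype.card κ := by exact_mod_cast Fintype.card_pos
  generalize (Fintype.card ι : ℝ) = m at *
  generalize (Fintype.card κ : ℝ) = l at *
  set c : Fin N → ℝ := fun n => (m + l) * q n / 2
  -- Translating s by c n splits the second argument (m + l)(q n - q n')/2 - s into -c n' - s, so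
  -- the index n stays in `a` and n' in `b`. Translations and phases leave the L² norms unchanged.
  set a : Fin N → ℝ × ℝ → ℂ := fun n t =>
    Complex.exp (((p n * ((m + l) * t.1) : ℝ) : ℂ) * Complex.I) * fibreCorr i₀ φ (t.1, t.2 + c n)
  set b : Fin N → ℝ × ℝ → ℂ := fun n t =>
    Complex.exp (((-(p n * ((m + l) * t.1)) : ℝ) : ℂ) * Complex.I) *
      fibreCorr k₀ χ (t.1, -c n - t.2)
  have ham : ∀ n, AEStronglyMeasurable (a n) volume := fun n =>
    (Measurable.mul (by fun_prop) (hAm.measurable.comp (by fun_prop))).aestronglyMeasurable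
  have hbm : ∀ n, AEStronglyMeasurable (b n) volume := fun n =>
    (Measurable.mul (by fun_prop) (hBm.measurable.comp (by fun_prop))).aestronglyMeasurable
  have hS : ∀ n, MeasurePreserving (fun t : ℝ × ℝ => (t.1, t.2 + c n)) := fun n =>
    (MeasurePreserving.id volume).prod (measurePreserving_add_right volume (c n))
  have hS' : ∀ n, MeasurePreserving (fun t : ℝ × ℝ => (t.1, -c n - t.2)) := fun n =>
    (MeasurePreserving.id volume).prod (Measure.measurePreserving_sub_left volume (-c n))
  have hSe : ∀ n, MeasurableEmbedding (fun t : ℝ × ℝ => (t.1, t.2 + c n)) := fun n =>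
    MeasurableEmbedding.id.prodMap (measurableEmbedding_addRight (c n))
  have hKa : ∀ n, ∫⁻ t, ‖a n t‖ₑ ^ 2 ≤
      ENNReal.ofReal (1 / (2 * m)) * (∫⁻ x, ‖φ x‖ₑ ^ 2) ^ 2 := fun n => by
    refine le_trans (le_of_eq ?_) hgA
    rw [← (hS n).lintegral_comp (f := fun t => ‖fibreCorr i₀ φ t‖ₑ ^ 2)
      (hAm.measurable.enorm.pow_const 2)]
    refine lintegral_congr fun t => ?_
    rw [enorm_mul, ← ofReal_norm (Complex.exp _), Complex.norm_exp_ofReal_mul_I,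
      ENNReal.ofReal_one, one_mul]
  have hKb : ∀ n, ∫⁻ t, ‖b n t‖ₑ ^ 2 ≤
      ENNReal.ofReal (1 / (2 * l)) * (∫⁻ x, ‖χ x‖ₑ ^ 2) ^ 2 := fun n => by
    refine le_trans (le_of_eq ?_) hgB
    rw [← (hS' n).lintegral_comp (f := fun t => ‖fibreCorr k₀ χ t‖ₑ ^ 2)
      (hBm.measurable.enorm.pow_const 2)]
    refine lintegral_congr fun t => ?_
    rw [enorm_mul, ← ofReal_norm (Complex.exp _), Complex.norm_exp_ofReal_mul_I,
      ENNReal.ofReal_one, one_mul]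
  have hshift : ∀ n n' (t : ℝ × ℝ), a n t * b n' t =
      Complex.exp ((((p n - p n') * ((m + l) * t.1) : ℝ) : ℂ) * Complex.I) *
        (fibreCorr i₀ φ (t.1, t.2 + c n) *
          fibreCorr k₀ χ (t.1, (m + l) * (q n - q n') / 2 - (t.2 + c n))) := fun n n' t => by
    have h1 : (m + l) * (q n - q n') / 2 - (t.2 + c n) = -c n' - t.2 := by
      simp only [c]
      ring
    have h2 : (((p n - p n') * ((m + l) * t.1) : ℝ) : ℂ) * Complex.I =
        ((p n * ((m + l) * t.1) : ℝ) : ℂ) * Complex.I +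
          ((-(p n' * ((m + l) * t.1)) : ℝ) : ℂ) * Complex.I := by
      push_cast
      ring
    rw [h1, h2, Complex.exp_add]
    simp only [a, b]
    ring
  have hab : ∀ n n', Integrable (fun t => a n t * b n' t) := fun n n' => by
    simp only [hshift]
    exact ((hS n).integrable_comp_emb (hSe n)).2 (hI n n').1
  have hE : ∀ n n', ∫ x, blockIntegrand φ χ (q n - q n') (p n - p n') x
      = ((m + l : ℝ) : ℂ) * ∫ t, a n t * b n' t := fun n n' => by
    rw [(hI n n').2]
    simp only [hshift]
    exact congrArg _ ((hS n).integral_comp (hSe n) _).symm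
  have key := enorm_sum_integral_le hU ham hbm hab hKa hKb
  simp only [hE]
  have hfac : ∑ n, ∑ n', U n n' * (((m + l : ℝ) : ℂ) * ∫ t, a n t * b n' t)
      = ((m + l : ℝ) : ℂ) * ∑ n, ∑ n', U n n' * ∫ t, a n t * b n' t := by
    simp only [Finset.mul_sum]
    exact Finset.sum_congr rfl fun n _ => Finset.sum_congr rfl fun n' _ => by ring
  rw [hfac, norm_mul, Complex.norm_real, Real.norm_of_nonneg (by positivity)]
  set X := ∑ n, ∑ n', U n n' * ∫ t, a n t * b n' t
  have hX : ‖X‖ ^ 2 ≤ (N * (1 / (2 * m) * w ^ 2)) * (N * (1 / (2 * l) * w' ^ 2)) := by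
    rw [hw, hw', ← ENNReal.ofReal_pow hw0, ← ENNReal.ofReal_pow hw0', ← ENNReal.ofReal_mul
      (by positivity), ← ENNReal.ofReal_mul (by positivity), ← ENNReal.ofReal_natCast,
      ← ENNReal.ofReal_mul (by positivity), ← ENNReal.ofReal_mul (by positivity),
      ← ENNReal.ofReal_mul (by positivity), ← ofReal_norm,
      ← ENNReal.ofReal_pow (norm_nonneg _)] at key
    exact (ENNReal.ofReal_le_ofReal_iff (by positivity)).1 key
  have hX' : ‖X‖ ≤ N * (w * w') / (2 * √(m * l)) := by
    refine abs_le_of_sq_le_sq' ?_ (by positivity) |>.2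
    refine hX.trans (le_of_eq ?_)
    rw [div_pow, mul_pow 2, Real.sq_sqrt (by positivity)]
    field_simp
  calc (m + l) * ‖X‖ ≤ (m + l) * (N * (w * w') / (2 * √(m * l))) := by gcongr
    _ = _ := by ring

end Bipartite

/-! ### The bound for biseparable mixtures -/

theorem lintegral_sq_enorm_eq {ι : Type} [Fintype ι] (f : ModeSpace ι) :
    ∫⁻ x, ‖f x‖ₑ ^ 2 = ENNReal.ofReal (‖f‖ ^ 2) := by
  have h := eLpNorm_eq_lintegral_rpow_enorm_toReal (p := 2) two_ne_zero ENNReal.ofNat_ne_top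
    (f := f) (μ := volume)
  rw [ENNReal.ofReal_pow (norm_nonneg _), Lp.norm_def, ENNReal.ofReal_toReal (Lp.eLpNorm_ne_top f),
    h, ← ENNReal.rpow_two, ← ENNReal.rpow_mul]
  simp

section Tensor

variable {M : ℕ} (A : Finset (Fin M))

theorem sum_mem_add_sum_notMem (x : Fin M → ℝ) :
    ∑ i : {m // m ∈ A}, x i + ∑ i : {m // m ∉ A}, x i = ∑ i, x i := by
  convert Fintype.sum_subtype_add_sum_subtype (fun m => m ∈ A) x

theorem card_mem_add_card_notMem :
    (Fintype.card {m // m ∈ A} + Fintype.card {m // m ∉ A} : ℝ) = M := by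
  simpa using sum_mem_add_sum_notMem A fun _ => 1

/-- Each coordinate of Rx - q·1 is a common number, fixed by the total position, minus the same
coordinate of x; hence a product function stays a product over the blocks once the total is fixed.
-/
theorem inner_relParity_displacement_ae (f : ModeSpace {m // m ∈ A}) (g : ModeSpace {m // m ∉ A})
    (η : ℂ) : (fun x => ⟪tensor A f g x,
      relParity M (displacement (fun _ => η) (tensor A f g)) x⟫_ℂ) =ᵐ[volume]
      fun x => blockIntegrand f g (√2 * η.re) (√2 * η.im) (splitModes A x) := by
  have hS : MeasurePreserving fun x : Fin M → ℝ => relReflection M x - fun _ => √2 * η.re :=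
    (measurePreserving_sub_right volume _).comp (measurePreserving_relReflection M)
  filter_upwards [coeFn_tensor A f g, relParity_displacement_ae η (tensor A f g),
    hS.quasiMeasurePreserving.ae (coeFn_tensor A f g)] with x h1 h2 h3
  rw [h1, h2, h3, RCLike.inner_apply, mul_comm, blockIntegrand, card_mem_add_card_notMem]
  have hs := sum_mem_add_sum_notMem A x
  have hp : √2 * η.im * ∑ m, x m - M * (η.re * η.im) = √2 * η.im *
      (∑ i, (splitModes A x).1 i + ∑ k, (splitModes A x).2 k - M * (√2 * η.re) / 2) := by
    simp only [splitModes_apply, hs]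
    have h := Real.mul_self_sqrt (zero_le_two (α := ℝ))
    linear_combination (M * η.re * η.im / 2) * h
  rw [hp]
  congr 4
  all_goals
    ext i
    simp only [splitModes_apply, relReflection_apply, Pi.sub_apply, hs]
    ring

theorem norm_sum_inner_tensor_le (hA : A.Nonempty) (hA' : Aᶜ.Nonempty) {N : ℕ}
    {U : Matrix (Fin N) (Fin N) ℂ} (hU : IsBilinContraction U) (ξ : Fin N → ℂ)
    (f : ModeSpace {m // m ∈ A}) (g : ModeSpace {m // m ∉ A}) :
    ‖∑ n, ∑ n', U n n' * ⟪tensor A f g,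
      relParity M (displacement (fun _ => ξ n - ξ n') (tensor A f g))⟫_ℂ‖ ≤
      N * (M / (2 * √((M : ℝ) - 1)) * ‖tensor A f g‖ ^ 2) := by
  have hne : Nonempty {m // m ∈ A} := hA.to_subtype
  obtain ⟨k, hk⟩ := hA'
  have hne' : Nonempty {m // m ∉ A} := ⟨⟨k, by simpa using hk⟩⟩
  have hE := measurePreserving_splitModes A
  have hEe := (splitModes A).measurableEmbedding
  have hint : ∀ η : ℂ, Integrable (blockIntegrand f g (√2 * η.re) (√2 * η.im)) := fun η =>
    (hE.integrable_comp_emb hEe).1 ((L2.integrable_inner _ _).congr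
      (inner_relParity_displacement_ae A f g η))
  have hinner : ∀ η : ℂ, ⟪tensor A f g, relParity M (displacement (fun _ => η) (tensor A f g))⟫_ℂ
      = ∫ x, blockIntegrand f g (√2 * η.re) (√2 * η.im) x := fun η => by
    rw [L2.inner_def, integral_congr_ae (inner_relParity_displacement_ae A f g η)]
    exact hE.integral_comp hEe _
  have hre : ∀ n n', √2 * (ξ n - ξ n').re = √2 * (ξ n).re - √2 * (ξ n').re := fun n n' => by
    rw [Complex.sub_re, mul_sub]
  have him : ∀ n n', √2 * (ξ n - ξ n').im = √2 * (ξ n).im - √2 * (ξ n').im := fun n n' => by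
    rw [Complex.sub_im, mul_sub]
  have key := norm_sum_blockIntegrand_le hU (Lp.stronglyMeasurable f).measurable
    (Lp.stronglyMeasurable g).measurable (by positivity) (by positivity) (lintegral_sq_enorm_eq f)
    (lintegral_sq_enorm_eq g) (fun n => √2 * (ξ n).re) (fun n => √2 * (ξ n).im)
    (fun n n' => by simpa only [← hre, ← him] using hint (ξ n - ξ n'))
  have hm : (1 : ℝ) ≤ Fintype.card {m // m ∈ A} := by
    exact_mod_cast Nat.succ_le_of_lt Fintype.card_pos
  have hl : (1 : ℝ) ≤ Fintype.card {m // m ∉ A} := by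
    exact_mod_cast Nat.succ_le_of_lt Fintype.card_pos
  have hM := card_mem_add_card_notMem A
  rw [hM] at key
  simp only [hinner, hre, him]
  refine key.trans ?_
  rw [norm_tensor, mul_pow]
  have h1 : 0 < (M : ℝ) - 1 := by linarith
  gcongr
  -- With m, l ≥ 1 the block sizes, (m - 1)(l - 1) ≥ 0 gives ml ≥ m + l - 1 = M - 1.
  nlinarith

end Tensor

/-- The contraction U depends only on C and is the same for all ensemble vectors, so the bound for
one product vector sums against the weights ‖vₛ‖², whose total is 1. -/
theorem matrixTraceNorm_witnessMatrix_le {M N : ℕ}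
    {ρ : ModeSpace (Fin M) →L[ℂ] ModeSpace (Fin M)} (hρ : IsBiseparableMixture ρ)
    (ξ : Fin N → ℂ) : matrixTraceNorm (witnessMatrix ρ ξ) ≤ M / (2 * √((M : ℝ) - 1)) := by
  obtain ⟨σ, A, φ, χ, hA, hens⟩ := hρ.exists_isEnsemble
  obtain ⟨U, hU, hUC⟩ := exists_isBilinContraction_sum_eq (witnessMatrix ρ ξ)
  set K : ℝ := M / (2 * √((M : ℝ) - 1))
  set v : σ → ModeSpace (Fin M) := fun s => tensor (A s) (φ s) (χ s)
  set e : Fin N → Fin N → σ → ℂ := fun n n' s =>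
    ⟪v s, relParity M (displacement (fun _ => ξ n - ξ n') (v s))⟫_ℂ
  have hsum : ∀ n n', Summable (e n n') := fun n n' => by
    set B := relParity M ∘L displacement fun _ => ξ n - ξ n'
    refine .of_norm_bounded (hens.hasSum_weight.summable.mul_left ‖B‖) fun s => ?_
    calc ‖e n n' s‖ ≤ ‖v s‖ * ‖B (v s)‖ := norm_inner_le_norm _ _
      _ ≤ ‖v s‖ * (‖B‖ * ‖v s‖) := by gcongr; exact B.le_opNorm _
      _ = _ := by ring
  have htot : HasSum (fun s => 1 / (N : ℂ) * ∑ n, ∑ n', U n n' * e n n' s)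
      (matrixTraceNorm (witnessMatrix ρ ξ) : ℂ) := by
    have h := (hasSum_sum (s := Finset.univ) fun n _ => hasSum_sum (s := Finset.univ) fun n' _ =>
      (hsum n n').hasSum.mul_left (U n n')).mul_left (1 / (N : ℂ))
    refine (congrArg (HasSum _) ?_).mpr h
    rw [← hUC]
    simp only [witnessMatrix_apply hens, Finset.mul_sum]
    exact Finset.sum_congr rfl fun n _ => Finset.sum_congr rfl fun n' _ => mul_left_comm _ _ _
  have hbound : ∀ s, ‖1 / (N : ℂ) * ∑ n, ∑ n', U n n' * e n n' s‖ ≤ K * ‖v s‖ ^ 2 := fun s => by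
    have h := norm_sum_inner_tensor_le (A s) (hA s).1 (hA s).2 hU ξ (φ s) (χ s)
    have hK : 0 ≤ K * ‖v s‖ ^ 2 := by positivity
    rw [norm_mul, norm_div, norm_one, Complex.norm_natCast]
    calc _ ≤ 1 / (N : ℝ) * (N * (K * ‖v s‖ ^ 2)) := by gcongr
      _ ≤ K * ‖v s‖ ^ 2 := by
        -- An inequality suffices and also covers N = 0, where N⁻¹ * N = 0.
        rw [← mul_assoc, one_div]
        exact mul_le_of_le_one_left hK inv_mul_le_one
  have h1 := tsum_of_norm_bounded (hens.hasSum_weight.mul_left K) hbound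
  rw [htot.tsum_eq, Complex.norm_real, mul_one] at h1
  exact (le_abs_self _).trans h1

end CVWitness

end

/-! ### Conclusion: circuit formula, Hermiticity and entanglement criterion -/

open CVWitness in
theorem mainTheorem4 (M : ℕ) (hM : 2 ≤ M)
    (ρ : ModeSpace (Fin M) →L[ℂ] ModeSpace (Fin M)) (hρ : IsDensity ρ)
    (N : ℕ) (ξ : Fin N → ℂ) :
    (∀ n n', ∃ c : ℂ,
      HasTrace (circuitOperator ρ (ξ n - ξ n')) c ∧
      HasTrace (ρ ∘L relParity M ∘L displacement fun _ : Fin M => ξ n - ξ n') c ∧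
      witnessMatrix ρ ξ n n' = 1 / (N : ℂ) * c) ∧
    (witnessMatrix ρ ξ).IsHermitian ∧
    (matrixTraceNorm (witnessMatrix ρ ξ) > (M : ℝ) / (2 * √((M : ℝ) - 1)) → IsGME ρ) := by
  obtain ⟨σ, v, hv⟩ := exists_isEnsemble hρ
  exact ⟨fun n n' => ⟨_, (exists_hasTrace hv _).1, (exists_hasTrace hv _).2,
    witnessMatrix_apply hv ξ n n'⟩, isHermitian_witnessMatrix hv ξ,
    fun h hsep => h.not_ge (matrixTraceNorm_witnessMatrix_le hsep ξ)⟩
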